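/- Let $k$ be an algebraically closed field. A $k$-variety is a reduced separated scheme of finite type over $k$ (not necessarily irreducible); its points are its closed points, i.e. its $k$-rational points, with the Zariski topology. For a $k$-variety $X$, let $\mathrm{Bir}(X)$ be the set of birational maps $X\dashrightarrow X$ over $k$ (rational maps represented by a $k$-isomorphism between two dense open subsets of $X$), and for an integer $n\ge 1$ let $\mathrm{Cr}_n(k)=\mathrm{Bir}(\mathbb{P}^n_k)$ be the Cremona group. For a $k$-variety $A$, a map $A\to\mathrm{Bir}(X)$ is called a morphism if it has the form $a\mapsto f_a$, where $f\colon A\times X\dashrightarrow X$ is a rational map over $k$, defined on a dense open subset $U\subset A\times X$, such that for every point $a\in A$ the set $U_a=U\cap(\{a\}\times X)$ is dense in $\{a\}\times X$ and $f|_{U_a}$ is an isomorphism of $U_a$ onto a dense open subset of $X$, and where $f_a\in\mathrm{Bir}(X)$ is the birational map $x\dashrightarrow f(a,x)$. The Zariski topology on $\mathrm{Bir}(X)$ is the one in which a subset $R$ is closed if and only if, for every $k$-variety $A$ and every morphism $A\to\mathrm{Bir}(X)$, the preimage of $R$ is closed in $A$. Theorem. For every $n\ge 1$, $\mathrm{Cr}_n(k)$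 is linearly connected: for all $f,g\in\mathrm{Cr}_n(k)$ there exist an open subset $U$ of the affine line $\mathbb{A}^1_k$ containing $0$ and $1$, and a morphism $\theta\colon U\to\mathrm{Cr}_n(k)$ such that $\theta(0)=f$ and $\theta(1)=g$. In particular, $\mathrm{Cr}_n(k)$ is connected for the Zariski topology. -/

import Mathlib

open CategoryTheory CategoryTheory.Limits AlgebraicGeometry

universe u

noncomputable section

namespace Cremona

variable {k : Type u} [Field k]

/-- `A` is a `k`-variety via the structure morphism `sA`: a reduced separated scheme of finite
type over `k` (not necessarily irreducible). -/
class IsVariety {A : Scheme.{u}} (sA : A ⟶ Spec (.of k)) : Prop where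
  isReduced : IsReduced A
  isSeparated : IsSeparated sA
  locallyOfFiniteType : LocallyOfFiniteType sA
  quasiCompact : QuasiCompact sA

/-- The set `A(k)` of `k`-rational points of a `k`-scheme. If `k` is algebraically closed and `A`
is of finite type over `k`, these are the closed points of `A`, that is, the points of `A` in the
sense of classical algebraic geometry. -/
def Points {A : Scheme.{u}} (sA : A ⟶ Spec (.of k)) : Type u :=
  {p : Spec (.of k) ⟶ A // p ≫ sA = 𝟙 _}

/-- The Zariski topology on `A(k)`. -/
instance {A : Scheme.{u}} (sA : A ⟶ Spec (.of k)) : TopologicalSpace (Points sA) :=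
  TopologicalSpace.induced (fun p ↦ p.1 (IsLocalRing.closedPoint k)) inferInstance

/-- `Bir(X)`: the set of birational maps `X ⤏ X` over `k`, i.e. of those rational maps which are
represented by a `k`-isomorphism between two dense open subschemes of `X`. -/
def Bir {X : Scheme.{u}} (sX : X ⟶ Spec (.of k)) : Type u :=
  {f : X ⤏ X // ∃ e : X.PartialIso X, e.IsOver sX sX ∧ e.toRationalMap = f}

section Family

variable {A X : Scheme.{u}} (sA : A ⟶ Spec (.of k)) (sX : X ⟶ Spec (.of k))

variable {sA} in
/-- For a `k`-rational point `a` of `A`, the morphism `X ⟶ A × X`, `x ↦ (a, x)`, which identifies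
`X` with `{a} × X`. -/
def fiberInclusion (a : Points sA) : X ⟶ pullback sA sX :=
  pullback.lift (sX ≫ a.1) (𝟙 X) (by simp [a.2])

lemma fiberInclusion_snd (a : Points sA) :
    fiberInclusion sX a ≫ pullback.snd sA sX = 𝟙 X :=
  pullback.lift_snd _ _ _

/-- An algebraic family of elements of `Bir(X)` parametrised by `A`: a rational map
`A × X ⤏ X` over `k`, defined on a dense open subset `U` of `A × X`, such that for every point `a`
of `A` the open subset `U_a = U ∩ ({a} × X)` is dense in `{a} × X`, and the restriction of the map
to `U_a` is an isomorphism onto a dense open subset of `X`. -/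
structure AlgebraicFamily where
  toPartialMap : (pullback sA sX).PartialMap X
  isOver : toPartialMap.hom ≫ sX = toPartialMap.domain.ι ≫ pullback.snd sA sX ≫ sX
  dense_fiber (a : Points sA) :
    Dense ((fiberInclusion sX a ⁻¹ᵁ toPartialMap.domain : X.Opens) : Set X)
  isOpenImmersion (a : Points sA) :
    IsOpenImmersion ((fiberInclusion sX a ∣_ toPartialMap.domain) ≫ toPartialMap.hom)
  isDominant (a : Points sA) :
    IsDominant ((fiberInclusion sX a ∣_ toPartialMap.domain) ≫ toPartialMap.hom)

variable {sA sX}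

/-- The partial map `x ↦ f(a, x)` from `X` to `X`, defined on `U_a`. -/
def AlgebraicFamily.fiber (F : AlgebraicFamily sA sX) (a : Points sA) : X.PartialMap X where
  domain := fiberInclusion sX a ⁻¹ᵁ F.toPartialMap.domain
  dense_domain := F.dense_fiber a
  hom := (fiberInclusion sX a ∣_ F.toPartialMap.domain) ≫ F.toPartialMap.hom

lemma AlgebraicFamily.fiber_mem (F : AlgebraicFamily sA sX) (a : Points sA) :
    ∃ e : X.PartialIso X, e.IsOver sX sX ∧ e.toRationalMap = (F.fiber a).toRationalMap := by
  have h1 : IsOpenImmersion (F.fiber a).hom := F.isOpenImmersion a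
  have h2 : IsDominant (F.fiber a).hom := F.isDominant a
  refine ⟨⟨(F.fiber a).domain, (F.fiber a).dense_domain, (F.fiber a).hom.opensRange,
    (F.fiber a).hom.denseRange, (F.fiber a).hom.isoOpensRange⟩, ?_, ?_⟩
  · have h : (F.fiber a).hom ≫ sX = (F.fiber a).domain.ι ≫ sX := by
      simp only [AlgebraicFamily.fiber, Category.assoc]
      rw [F.isOver, morphismRestrict_ι_assoc, ← Category.assoc (fiberInclusion sX a),
        fiberInclusion_snd, Category.id_comp]
    simpa [Scheme.PartialIso.IsOver] using h
  · exact congrArg (fun h ↦ Scheme.PartialMap.toRationalMap ⟨_, (F.fiber a).dense_domain, h⟩)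
      (F.fiber a).hom.isoOpensRange_hom_ι

/-- The element `f_a` of `Bir(X)`. -/
def AlgebraicFamily.eval (F : AlgebraicFamily sA sX) (a : Points sA) : Bir sX :=
  ⟨(F.fiber a).toRationalMap, F.fiber_mem a⟩

/-- A map from (the points of) `A` to `Bir(X)` is a morphism if it is given by an algebraic
family. -/
def IsMorphism (φ : Points sA → Bir sX) : Prop :=
  ∃ F : AlgebraicFamily sA sX, φ = F.eval

end Family

/-- The Zariski topology on `Bir(X)`: a subset is closed if and only if its preimage under every
morphism `A → Bir(X)` from a `k`-variety `A` is closed. -/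
instance {X : Scheme.{u}} (sX : X ⟶ Spec (.of k)) : TopologicalSpace (Bir sX) :=
  TopologicalSpace.ofClosed
    {R | ∀ (A : Scheme.{u}) (sA : A ⟶ Spec (.of k)) (_ : IsVariety sA)
      (φ : Points sA → Bir sX), IsMorphism φ → IsClosed (φ ⁻¹' R)}
    (fun _ _ _ _ _ ↦ by simp)
    (fun S hS A sA hA φ hφ ↦ by
      rw [Set.preimage_sInter]
      exact isClosed_biInter fun R hR ↦ hS hR A sA hA φ hφ)
    (fun R hR R' hR' A sA hA φ hφ ↦ by
      rw [Set.preimage_union]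
      exact (hR A sA hA φ hφ).union (hR' A sA hA φ hφ))

variable (k)

/-- The affine line over `k`. -/
abbrev AffineLine : Scheme.{u} := AffineSpace PUnit.{u + 1} (Spec (.of k))

/-- The structure morphism of the affine line. -/
abbrev AffineLine.hom : AffineLine k ⟶ Spec (.of k) := AffineLine k ↘ Spec (.of k)

/-- The point of the affine line with coordinate `0`. -/
def AffineLine.zero : Spec (.of k) ⟶ AffineLine k :=
  AffineSpace.homOfVector (𝟙 _) (fun _ ↦ 0)

/-- The point of the affine line with coordinate `1`. -/
def AffineLine.one : Spec (.of k) ⟶ AffineLine k :=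
  AffineSpace.homOfVector (𝟙 _) (fun _ ↦ 1)

attribute [local instance] MvPolynomial.gradedAlgebra

/-- The projective space of dimension `n` over `k`, i.e. `Proj k[x₀, …, xₙ]`. -/
abbrev ProjectiveSpace (n : ℕ) : Scheme.{u} :=
  Proj (MvPolynomial.homogeneousSubmodule (Fin (n + 1)) k)

/-- The structure morphism of projective space. -/
def ProjectiveSpace.hom (n : ℕ) : ProjectiveSpace k n ⟶ Spec (.of k) :=
  Proj.toSpecZero (MvPolynomial.homogeneousSubmodule (Fin (n + 1)) k) ≫
    Spec.map (CommRingCat.ofHom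
      (algebraMap k (MvPolynomial.homogeneousSubmodule (Fin (n + 1)) k 0)))

/-- The Cremona group `Cr_n(k) = Bir(ℙⁿ)`. -/
abbrev Cr (n : ℕ) : Type u := Bir (ProjectiveSpace.hom k n)

variable {k}

/-- `Bir(X)` is linearly connected: for all `f` and `g` there are an open subset `U` of the affine
line which contains `0` and `1`, and a morphism `θ : U → Bir(X)` with `θ(0) = f` and `θ(1) = g`. -/
def IsLinearlyConnected {X : Scheme.{u}} (sX : X ⟶ Spec (.of k)) : Prop :=
  ∀ f g : Bir sX, ∃ (U : (AffineLine k).Opens) (θ : Points (U.ι ≫ AffineLine.hom k) → Bir sX)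
    (p₀ p₁ : Points (U.ι ≫ AffineLine.hom k)),
    IsMorphism θ ∧ p₀.1 ≫ U.ι = AffineLine.zero k ∧ p₁.1 ≫ U.ι = AffineLine.one k ∧
      θ p₀ = f ∧ θ p₁ = g

end Cremona

end

noncomputable section

namespace Cremona

/-! ### Rational maps that agree on a dense open; families extended from an open chart -/

section

variable {k : Type u} [Field k]

/-! Projective space is irreducible and contains `𝔸ⁿ` as an open subscheme. Seen in this chart, `f`
and `g` differ by `t = f⁻¹ g`, an open immersion of a nonempty open `N ⊆ 𝔸ⁿ` into `𝔸ⁿ`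
(`exists_transition`). It suffices to join the identity to `t` by a family `h_s` and to take `f ∘
h_s`, restricted to the locus where `h_s` lands in the domain of `f`.

Since `k` is infinite, `N` has a rational point `p`. An open immersion is a monomorphism, so the
Jacobian `J` of `t` at `p` is invertible (`LocalExpression.isUnit_J`). The rescaled map `(t(p + s(x
- p)) - t(p)) / s` has no pole along `s = 0`, where it becomes the linear map `J(x - p)`. Correcting
it by affine maps, put `h_s(x) = s t(p) + (1 - s) p + (s + (1 - s) J⁻¹) (t(p + s(x - p)) - t(p)) /
s`. Then `h_0` is the identity and `h_1 = t`. For `s ≠ 0` the map `h_s` is an affine map after `t`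
after a homothety, hence an open immersion as soon as `det(s + (1 - s) J⁻¹) ≠ 0`. This determinant
is nonzero at `0` and at `1`, and the parameter space `U` is its nonvanishing locus
(`exists_family_through`).

Connectedness follows: morphisms to `Bir(X)` are continuous by the definition of the topology, and
the rational points of an open subset of the line form an irreducible space. -/

lemma le_of_comp_ι_eq {X N : Scheme.{u}} {u : N ⟶ X} [IsOpenImmersion u] {D : X.Opens}
    {c : N ⟶ D} (hc : c ≫ D.ι = u) : u.opensRange ≤ D := by
  subst hc
  rintro _ ⟨x, rfl⟩
  rw [Scheme.Hom.comp_apply]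
  exact (c x).2

lemma dense_opensRange {X N : Scheme.{u}} [IrreducibleSpace X] [Nonempty N] (u : N ⟶ X)
    [IsOpenImmersion u] : Dense (u.opensRange : Set X) :=
  u.opensRange.isOpen.dense ⟨u (Classical.arbitrary N), Classical.arbitrary N, rfl⟩

/-- By irreducibility the image of `u` is dense, and agreement there determines a rational map.
Allowing an arbitrary open immersion `u` permits a comparison on schemes that are only isomorphic to
open subschemes of `X`. -/
lemma toRationalMap_eq_of_comp_eq {X Y N : Scheme.{u}} [IrreducibleSpace X] [Nonempty N]
    (u : N ⟶ X) [IsOpenImmersion u] {p q : X.PartialMap Y} (a : N ⟶ p.domain) (b : N ⟶ q.domain)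
    (ha : a ≫ p.domain.ι = u) (hb : b ≫ q.domain.ι = u) (h : a ≫ p.hom = b ≫ q.hom) :
    p.toRationalMap = q.toRationalMap := by
  have key : ∀ (D : X.Opens) (c : N ⟶ D) (hc : c ≫ D.ι = u),
      u.isoOpensRange.hom ≫ X.homOfLE (le_of_comp_ι_eq hc) = c := by
    intro D c hc
    rw [← cancel_mono D.ι]
    simp [hc]
  rw [Scheme.PartialMap.toRationalMap_eq_iff]
  refine ⟨u.opensRange, dense_opensRange u, le_of_comp_ι_eq ha, le_of_comp_ι_eq hb, ?_⟩
  have : u.isoOpensRange.hom ≫ X.homOfLE (le_of_comp_ι_eq ha) ≫ p.hom =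
      u.isoOpensRange.hom ≫ X.homOfLE (le_of_comp_ι_eq hb) ≫ q.hom := by
    rw [reassoc_of% key _ a ha, reassoc_of% key _ b hb, h]
  exact (cancel_epi u.isoOpensRange.hom).1 this

section Extend

variable {A X E : Scheme.{u}} {sA : A ⟶ Spec (.of k)} {sX : X ⟶ Spec (.of k)}
  {sE : E ⟶ Spec (.of k)} (j : E ⟶ X) (hj : j ≫ sX = sE)

variable (sA) in
/-- The base change `A × E ⟶ A × X` of a morphism `E ⟶ X`. -/
def prodMap : pullback sA sE ⟶ pullback sA sX :=
  pullback.lift (pullback.fst sA sE) (pullback.snd sA sE ≫ j)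
    (by simp [pullback.condition, hj])

lemma prodMap_snd : prodMap sA j hj ≫ pullback.snd sA sX = pullback.snd sA sE ≫ j :=
  pullback.lift_snd _ _ _

lemma prodMap_fst : prodMap sA j hj ≫ pullback.fst sA sX = pullback.fst sA sE :=
  pullback.lift_fst _ _ _

lemma isPullback_prodMap :
    IsPullback (pullback.snd sA sE) (prodMap sA j hj) j (pullback.snd sA sX) := by
  refine IsPullback.of_bot (v₂₁ := pullback.fst sA sX) (v₂₂ := sX) (h₃₁ := sA) ?_
    (prodMap_snd j hj).symm (IsPullback.of_hasPullback _ _).flip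
  rw [prodMap_fst, hj]
  exact (IsPullback.of_hasPullback _ _).flip

instance [IsOpenImmersion j] : IsOpenImmersion (prodMap sA j hj) :=
  MorphismProperty.of_isPullback (P := @IsOpenImmersion) (isPullback_prodMap j hj) inferInstance

lemma fiberInclusion_fst (a : Points sA) :
    fiberInclusion sX a ≫ pullback.fst sA sX = sX ≫ a.1 :=
  pullback.lift_fst _ _ _

lemma fiberInclusion_prodMap (a : Points sA) :
    fiberInclusion sE a ≫ prodMap sA j hj = j ≫ fiberInclusion sX a := by
  apply pullback.hom_ext
  · rw [Category.assoc, prodMap_fst, Category.assoc, fiberInclusion_fst, fiberInclusion_fst,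
      reassoc_of% hj]
  · rw [Category.assoc, prodMap_snd, Category.assoc, fiberInclusion_snd,
      ← Category.assoc, fiberInclusion_snd, Category.id_comp, Category.comp_id]

/-- Cancel the projections: the outer rectangle has identities as horizontal sides. Hence taking the
fibre over `a` commutes with pushing an open of `A × E` forward to `A × X`, which is the content of
`fiberIso`. -/
lemma isPullback_fiberInclusion (a : Points sA) :
    IsPullback (fiberInclusion sE a) j (prodMap sA j hj) (fiberInclusion sX a) := by
  refine IsPullback.of_right (h₁₂ := pullback.snd sA sE) (h₂₂ := pullback.snd sA sX) (v₁₃ := j) ?_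
    (fiberInclusion_prodMap j hj a) (isPullback_prodMap j hj)
  rw [fiberInclusion_snd, fiberInclusion_snd]
  exact IsPullback.of_horiz_isIso ⟨by simp⟩

variable (V : (pullback sA sE).Opens)

lemma isPullback_fiberInclusion_restrict (a : Points sA) :
    IsPullback (fiberInclusion sE a ∣_ V) ((fiberInclusion sE a ⁻¹ᵁ V).ι ≫ j)
      (V.ι ≫ prodMap sA j hj) (fiberInclusion sX a) :=
  (isPullback_morphismRestrict (fiberInclusion sE a) V).paste_vert
    (isPullback_fiberInclusion j hj a)

variable [IsOpenImmersion j]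

/-- The fibre over `a` of `V ⊆ A × E`, seen as an open subscheme of `X`. -/
def fiberIso (a : Points sA) : (fiberInclusion sE a ⁻¹ᵁ V).toScheme ≅
    (fiberInclusion sX a ⁻¹ᵁ (V.ι ≫ prodMap sA j hj).opensRange).toScheme :=
  IsPullback.isoIsPullback _ _
    ((isPullback_fiberInclusion_restrict j hj V a).of_iso (Iso.refl _)
      (V.ι ≫ prodMap sA j hj).isoOpensRange (Iso.refl _) (Iso.refl _)
      (fst' := fiberInclusion sE a ∣_ V ≫ (V.ι ≫ prodMap sA j hj).isoOpensRange.hom)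
      (snd' := (fiberInclusion sE a ⁻¹ᵁ V).ι ≫ j)
      (f' := (V.ι ≫ prodMap sA j hj).opensRange.ι) (g' := fiberInclusion sX a)
      (by simp) (by simp) (by simp) (by simp))
    (isPullback_morphismRestrict (fiberInclusion sX a) (V.ι ≫ prodMap sA j hj).opensRange)

lemma fiberIso_hom_ι (a : Points sA) : (fiberIso j hj V a).hom ≫ Scheme.Opens.ι _ =
    (fiberInclusion sE a ⁻¹ᵁ V).ι ≫ j :=
  IsPullback.isoIsPullback_hom_snd ..

lemma fiberIso_hom_restrict (a : Points sA) :
    (fiberIso j hj V a).hom ≫ fiberInclusion sX a ∣_ (V.ι ≫ prodMap sA j hj).opensRange =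
    fiberInclusion sE a ∣_ V ≫ (V.ι ≫ prodMap sA j hj).isoOpensRange.hom :=
  IsPullback.isoIsPullback_hom_fst ..

/-- A `k`-morphism `m : V ⟶ X` on an open subscheme `V` of `A × E`, with `E` open in `X`, defines
an algebraic family of birational maps of `X` as soon as it restricts to an open immersion of a
nonempty scheme over each point of `A`. -/
def AlgebraicFamily.extend [IrreducibleSpace X] [IrreducibleSpace ↥(pullback sA sX)]
    [Nonempty V] (m : V.toScheme ⟶ X) (hm : m ≫ sX = V.ι ≫ pullback.snd sA sE ≫ sE)
    (hV : ∀ a : Points sA, Nonempty (fiberInclusion sE a ⁻¹ᵁ V))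
    (hmV : ∀ a : Points sA, IsOpenImmersion (fiberInclusion sE a ∣_ V ≫ m)) :
    AlgebraicFamily sA sX := by
  -- Through `fiberIso` the fibre of the transported map becomes the fibre of `m`, so it inherits
  -- the property of being an open immersion.
  have key (a : Points sA) : fiberInclusion sX a ∣_ (V.ι ≫ prodMap sA j hj).opensRange ≫
      (V.ι ≫ prodMap sA j hj).isoOpensRange.inv ≫ m =
      (fiberIso j hj V a).inv ≫ fiberInclusion sE a ∣_ V ≫ m := by
    rw [Iso.eq_inv_comp, reassoc_of% fiberIso_hom_restrict j hj V, Iso.hom_inv_id_assoc]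
  have himm (a : Points sA) : IsOpenImmersion
      (fiberInclusion sX a ∣_ (V.ι ≫ prodMap sA j hj).opensRange ≫
      (V.ι ≫ prodMap sA j hj).isoOpensRange.inv ≫ m) := by
    have := hmV a
    rw [key]
    infer_instance
  have hne (a : Points sA) :
      Nonempty (fiberInclusion sX a ⁻¹ᵁ (V.ι ≫ prodMap sA j hj).opensRange) :=
    have := hV a
    ⟨(fiberIso j hj V a).hom (Classical.arbitrary _)⟩
  exact
  { toPartialMap :=
      { domain := (V.ι ≫ prodMap sA j hj).opensRange
        dense_domain := dense_opensRange _
        hom := (V.ι ≫ prodMap sA j hj).isoOpensRange.inv ≫ m }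
    isOver := by
      rw [← cancel_epi (V.ι ≫ prodMap sA j hj).isoOpensRange.hom]
      simp only [Category.assoc, Iso.hom_inv_id_assoc, Scheme.Hom.isoOpensRange_hom_ι_assoc,
        reassoc_of% prodMap_snd j hj]
      rw [hm, hj]
    dense_fiber a := by
      obtain ⟨x, hx⟩ := hne a
      exact (TopologicalSpace.Opens.isOpen _).dense ⟨x, hx⟩
    isOpenImmersion a := himm a
    isDominant a := by
      have := hne a
      have := himm a
      exact ⟨dense_opensRange (fiberInclusion sX a ∣_ (V.ι ≫ prodMap sA j hj).opensRange ≫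
        (V.ι ≫ prodMap sA j hj).isoOpensRange.inv ≫ m)⟩ }

/-- Used to identify the two end points of the path: it is enough that the fibre of `m` factors
through the partial isomorphism `e` representing `f`. -/
lemma AlgebraicFamily.extend_eval_eq [IrreducibleSpace X] [IrreducibleSpace ↥(pullback sA sX)]
    [Nonempty V] (m : V.toScheme ⟶ X) (hm : m ≫ sX = V.ι ≫ pullback.snd sA sE ≫ sE)
    (hV : ∀ a : Points sA, Nonempty (fiberInclusion sE a ⁻¹ᵁ V))
    (hmV : ∀ a : Points sA, IsOpenImmersion (fiberInclusion sE a ∣_ V ≫ m))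
    (a : Points sA) (f : Bir sX) (e : X.PartialIso X) (he : e.toRationalMap = f.1)
    (l : (fiberInclusion sE a ⁻¹ᵁ V).toScheme ⟶ e.source)
    (hl : l ≫ e.source.ι = (fiberInclusion sE a ⁻¹ᵁ V).ι ≫ j)
    (hlm : l ≫ e.iso.hom ≫ e.target.ι = fiberInclusion sE a ∣_ V ≫ m) :
    (extend j hj V m hm hV hmV).eval a = f := by
  have := hV a
  refine Subtype.ext (Eq.trans ?_ he)
  refine toRationalMap_eq_of_comp_eq ((fiberInclusion sE a ⁻¹ᵁ V).ι ≫ j)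
    (fiberIso j hj V a).hom l (fiberIso_hom_ι j hj V a) hl ?_
  refine Eq.trans ?_ hlm.symm
  change (fiberIso j hj V a).hom ≫ fiberInclusion sX a ∣_ (V.ι ≫ prodMap sA j hj).opensRange ≫
      (V.ι ≫ prodMap sA j hj).isoOpensRange.inv ≫ m = _
  rw [reassoc_of% fiberIso_hom_restrict j hj V, Iso.hom_inv_id_assoc]

end Extend

end

/-! ### The deformation formula, as algebra in an arbitrary `K`-algebra -/

section

section Homothety

variable {K ι : Type*} [Field K] {B B' : Type*} [CommRing B] [CommRing B']

/-- The substitution `x ↦ p + s (x - p)`, where `s` is a new variable. -/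
def homothety (p : ι → K) : MvPolynomial ι K →ₐ[K] Polynomial (MvPolynomial ι K) :=
  MvPolynomial.aeval fun i ↦ Polynomial.C (.C (p i)) +
    Polynomial.X * Polynomial.C (.X i - .C (p i))

/-- The evaluation of a polynomial in `x` and `s` at `x = ξ` and `s = σ`. -/
def evalTwo (κ : K →+* B) (ξ : ι → B) (σ : B) : Polynomial (MvPolynomial ι K) →+* B :=
  Polynomial.eval₂RingHom (MvPolynomial.eval₂Hom κ ξ) σ

lemma map_eval₂Hom (φ : B →+* B') (κ : K →+* B) (ξ : ι → B) (r : MvPolynomial ι K) :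
    φ (MvPolynomial.eval₂Hom κ ξ r) = MvPolynomial.eval₂Hom (φ.comp κ) (φ ∘ ξ) r := by
  simp [MvPolynomial.eval₂_comp_left, Function.comp_def]

lemma map_evalTwo (φ : B →+* B') (κ : K →+* B) (ξ : ι → B) (σ : B)
    (r : Polynomial (MvPolynomial ι K)) :
    φ (evalTwo κ ξ σ r) = evalTwo (φ.comp κ) (φ ∘ ξ) (φ σ) r := by
  rw [evalTwo, evalTwo, Polynomial.coe_eval₂RingHom, Polynomial.hom_eval₂,
    Polynomial.coe_eval₂RingHom]
  congr 1
  ext <;> simp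

lemma evalTwo_homothety (κ : K →+* B) (ξ : ι → B) (σ : B) (p : ι → K) (r : MvPolynomial ι K) :
    evalTwo κ ξ σ (homothety p r) =
      MvPolynomial.eval₂Hom κ (fun i ↦ κ (p i) + σ * (ξ i - κ (p i))) r := by
  suffices h : (evalTwo κ ξ σ).comp (homothety p : _ →+* _) =
      MvPolynomial.eval₂Hom κ (fun i ↦ κ (p i) + σ * (ξ i - κ (p i))) from
    congrArg (fun g : _ →+* B ↦ g r) h
  refine MvPolynomial.ringHom_ext (fun c ↦ ?_) fun i ↦ ?_
  · simp [homothety, evalTwo, ← MvPolynomial.algebraMap_eq,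
      IsScalarTower.algebraMap_apply K (MvPolynomial ι K) (Polynomial (MvPolynomial ι K))]
  · simp [homothety, evalTwo]

lemma evalTwo_zero (κ : K →+* B) (ξ : ι → B) (r : Polynomial (MvPolynomial ι K)) :
    evalTwo κ ξ 0 r = MvPolynomial.eval₂Hom κ ξ (r.coeff 0) := by
  simp [evalTwo, Polynomial.eval₂_at_zero]

/-- A multiple of a square-zero element only sees the constant term. -/
lemma mul_evalTwo_of_mul_self_eq_zero (κ : K →+* B) (ξ : ι → B) {σ : B} (hσ : σ * σ = 0)
    (r : Polynomial (MvPolynomial ι K)) :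
    σ * evalTwo κ ξ σ r = σ * MvPolynomial.eval₂Hom κ ξ (r.coeff 0) := by
  conv_lhs => rw [← Polynomial.X_mul_divX_add r]
  simp only [evalTwo, map_add, map_mul, Polynomial.coe_eval₂RingHom, Polynomial.eval₂_X,
    Polynomial.eval₂_C]
  rw [mul_add, ← mul_assoc, hσ, zero_mul, zero_add]

lemma eval₂Hom_comp (κ : K →+* B) (r : MvPolynomial ι K) (p : ι → K) :
    MvPolynomial.eval₂Hom κ (fun i ↦ κ (p i)) r = κ (MvPolynomial.eval p r) := by
  rw [MvPolynomial.eval, map_eval₂Hom]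
  rfl

variable [Fintype ι]

/-- Taylor expansion to first order in `s`: `r(p + s(x - p)) = r(p) + s · dr_p(x - p) + ⋯`. The
induction is the Leibniz rule. -/
lemma homothety_coeff (p : ι → K) (r : MvPolynomial ι K) :
    (homothety p r).coeff 0 = .C (MvPolynomial.eval p r) ∧
    (homothety p r).coeff 1 =
      ∑ l, .C (MvPolynomial.eval p (MvPolynomial.pderiv l r)) * (.X l - .C (p l)) := by
  classical
  induction r using MvPolynomial.induction_on with
  | C c =>
    rw [← MvPolynomial.algebraMap_eq, AlgHom.commutes,
      IsScalarTower.algebraMap_apply K (MvPolynomial ι K) (Polynomial (MvPolynomial ι K))]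
    simp [MvPolynomial.algebraMap_eq, Polynomial.coeff_C]
  | add r s hr hs =>
    simp only [map_add, Polynomial.coeff_add, hr.1, hr.2, hs.1, hs.2, add_mul,
      Finset.sum_add_distrib, and_self]
  | mul_X r i hr =>
    have h0 : (homothety p (.X i)).coeff 0 = .C (p i) := by simp [homothety]
    have h1 : (homothety p (.X i)).coeff 1 = .X i - .C (p i) := by
      simp [homothety, Polynomial.coeff_C]
    rw [map_mul, Polynomial.mul_coeff_zero, Polynomial.mul_coeff_one, h0, h1, hr.1, hr.2]
    refine ⟨by simp, ?_⟩
    simp only [Derivation.leibniz, MvPolynomial.pderiv_X, smul_eq_mul, map_add, map_mul,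
      MvPolynomial.eval_X, add_mul, Finset.sum_add_distrib, Finset.sum_mul]
    congr 1
    · rw [Finset.sum_eq_single i]
      · simp
      · intro l _ hl
        simp [Ne.symm hl]
      · simp
    · exact Finset.sum_congr rfl fun l _ ↦ by ring

/-- Vanishing at `p` makes the expansion divisible by `s`. The quotient `S` is what lets the family
extend across `s = 0`. -/
lemma exists_homothety_eq (p : ι → K) (r : MvPolynomial ι K) (hr : MvPolynomial.eval p r = 0) :
    ∃ (S : Polynomial (MvPolynomial ι K)) (J : ι → K), homothety p r = Polynomial.X * S ∧
      S.coeff 0 = ∑ l, .C (J l) * (.X l - .C (p l)) := by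
  refine ⟨(homothety p r).divX, fun l ↦ MvPolynomial.eval p (MvPolynomial.pderiv l r), ?_, ?_⟩
  · conv_lhs => rw [← Polynomial.X_mul_divX_add (homothety p r), (homothety_coeff p r).1, hr]
    simp
  · rw [Polynomial.coeff_divX, zero_add, (homothety_coeff p r).2]

variable (K ι) in
/-- The data of a rational map `x ↦ (P j / q ^ m j)` defined at the point `p`, together with its
first order expansion at `p`. -/
structure LocalExpression where
  p : ι → K
  q : MvPolynomial ι K
  P : ι → MvPolynomial ι K
  m : ι → ℕ
  S : ι → Polynomial (MvPolynomial ι K)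
  J : Matrix ι ι K
  eval_q : MvPolynomial.eval p q = 1
  homothety_eq (j : ι) :
    homothety p (P j - .C (MvPolynomial.eval p (P j)) * q ^ m j) = Polynomial.X * S j
  coeff_S (j : ι) : (S j).coeff 0 = ∑ l, .C (J j l) * (.X l - .C (p l))

namespace LocalExpression

lemma exists_of_eval_eq_one (p : ι → K) (q : MvPolynomial ι K) (P : ι → MvPolynomial ι K)
    (m : ι → ℕ) (hq : MvPolynomial.eval p q = 1) :
    ∃ L : LocalExpression K ι, L.p = p ∧ L.q = q ∧ L.P = P ∧ L.m = m := by
  choose S J hS hJ using fun j ↦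
    -- The normalisation `q(p) = 1` makes this numerator of `f_j - f_j(p)` vanish at `p`, and makes
    -- its differential there equal to that of `f_j`.
    exists_homothety_eq p (P j - .C (MvPolynomial.eval p (P j)) * q ^ m j) (by simp [hq])
  exact ⟨⟨p, q, P, m, S, J, hq, hS, hJ⟩, rfl, rfl, rfl, rfl⟩

variable (L : LocalExpression K ι)

/-- The value at `p`. -/
def value (j : ι) : K := MvPolynomial.eval L.p (L.P j)

/-- The denominator of the family. -/
def denom : Polynomial (MvPolynomial ι K) := homothety L.p L.q

lemma evalTwo_denom (κ : K →+* B) (ξ : ι → B) (σ : B) : evalTwo κ ξ σ L.denom =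
    MvPolynomial.eval₂Hom κ (fun i ↦ κ (L.p i) + σ * (ξ i - κ (L.p i))) L.q :=
  evalTwo_homothety ..

/-- The point `s f(p) + (1 - s) p`. -/
def center (i : ι) : Polynomial K :=
  Polynomial.X * Polynomial.C (L.value i) + (1 - Polynomial.X) * Polynomial.C (L.p i)

lemma eval_center_one (i : ι) : (L.center i).eval 1 = L.value i := by
  simp [center]

variable [DecidableEq ι]

/-- The matrix `s + (1 - s) J⁻¹`. -/
def mat : Matrix ι ι (Polynomial K) :=
  .of fun i j ↦ Polynomial.X * Polynomial.C ((1 : Matrix ι ι K) i j) +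
    (1 - Polynomial.X) * Polynomial.C (L.J⁻¹ i j)

/-- The coordinates of the family of maps
`x ↦ center s + mat s * (f (p + s (x - p)) - f p) / s`. -/
def coordinate (κ : K →+* B) (ξ : ι → B) (σ w : B) (i : ι) : B :=
  (L.center i).eval₂ κ σ + ∑ j, (L.mat i j).eval₂ κ σ * (evalTwo κ ξ σ (L.S j) * w ^ L.m j)

lemma map_coordinate (φ : B →+* B') (κ : K →+* B) (ξ : ι → B) (σ w : B) (i : ι) :
    φ (L.coordinate κ ξ σ w i) = L.coordinate (φ.comp κ) (φ ∘ ξ) (φ σ) (φ w) i := by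
  simp [coordinate, Polynomial.hom_eval₂, map_evalTwo]

/-- At `s = 0` the denominator is `q(p) = 1`, each `S j` becomes the `j`-th entry of `J(x - p)`, and
`p + J⁻¹ J (x - p) = x`. -/
lemma coordinate_zero (hJ : IsUnit L.J) (κ : K →+* B) (ξ : ι → B) (w : B)
    (hw : evalTwo κ ξ 0 L.denom * w = 1) (i : ι) : L.coordinate κ ξ 0 w i = ξ i := by
  have hJ' : L.J⁻¹ * L.J = 1 := Matrix.nonsing_inv_mul _ ((Matrix.isUnit_iff_isUnit_det _).1 hJ)
  have hw1 : w = 1 := by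
    rw [evalTwo_denom] at hw
    simpa [eval₂Hom_comp, L.eval_q, -MvPolynomial.coe_eval₂Hom] using hw
  have h1 : ∀ j, (L.mat i j).eval₂ κ 0 = κ (L.J⁻¹ i j) := by
    intro j
    simp [mat, Matrix.one_apply, apply_ite]
  have h2 : (L.center i).eval₂ κ 0 = κ (L.p i) := by
    simp [center]
  have h3 : ∀ j, evalTwo κ ξ 0 (L.S j) = ∑ l, κ (L.J j l) * (ξ l - κ (L.p l)) := by
    intro j
    rw [evalTwo_zero, L.coeff_S]
    simp
  rw [coordinate, h2, hw1]
  simp only [h1, h3, one_pow, mul_one, Finset.mul_sum]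
  rw [Finset.sum_comm]
  have h4 : ∀ l, ∑ j, κ (L.J⁻¹ i j) * (κ (L.J j l) * (ξ l - κ (L.p l))) =
      κ ((1 : Matrix ι ι K) i l) * (ξ l - κ (L.p l)) := by
    intro l
    rw [← hJ', Matrix.mul_apply, map_sum, Finset.sum_mul]
    exact Finset.sum_congr rfl fun j _ ↦ by rw [map_mul, mul_assoc]
  simp only [h4]
  simp [Matrix.one_apply, apply_ite κ]

/-- Here `φ` stands for `f(p + α(x - p))`. Since `S j · w ^ m j = (φ j - f_j(p)) / α`, the
coordinates are affine functions of `φ`, with linear part `mat α / α`. -/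
lemma coordinate_of_ne_zero (κ : K →+* B) (ξ : ι → B) (w : B) {α : K} (hα : α ≠ 0) (φ : ι → B)
    (hw : evalTwo κ ξ (κ α) L.denom * w = 1)
    (hφ : ∀ j, φ j * MvPolynomial.eval₂Hom κ (fun i ↦ κ (L.p i) + κ α * (ξ i - κ (L.p i))) L.q
      ^ L.m j = MvPolynomial.eval₂Hom κ (fun i ↦ κ (L.p i) + κ α * (ξ i - κ (L.p i))) (L.P j))
    (i : ι) : L.coordinate κ ξ (κ α) w i =
      κ ((L.center i).eval α - ∑ j, (L.mat i j).eval α * α⁻¹ * L.value j) +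
        ∑ j, κ ((L.mat i j).eval α * α⁻¹) * φ j := by
  have hακ : κ α⁻¹ * κ α = 1 := by rw [← map_mul, inv_mul_cancel₀ hα, map_one]
  have h1 : ∀ j, evalTwo κ ξ (κ α) (L.S j) * w ^ L.m j = κ α⁻¹ * (φ j - κ (L.value j)) := by
    intro j
    have := congrArg (evalTwo κ ξ (κ α)) (L.homothety_eq j)
    rw [evalTwo_homothety, map_mul, map_sub, map_mul, map_pow, ← hφ] at this
    rw [evalTwo_denom] at hw
    set Q := MvPolynomial.eval₂Hom κ (fun i ↦ κ (L.p i) + κ α * (ξ i - κ (L.p i))) L.q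
    have hX : evalTwo κ ξ (κ α) Polynomial.X = κ α := by simp [evalTwo]
    have hC : MvPolynomial.eval₂Hom κ (fun i ↦ κ (L.p i) + κ α * (ξ i - κ (L.p i)))
        (MvPolynomial.C (MvPolynomial.eval L.p (L.P j))) = κ (L.value j) := by
      simp [value]
    rw [hX, hC] at this
    have hw' : Q ^ L.m j * w ^ L.m j = 1 := by rw [← mul_pow, hw, one_pow]
    linear_combination (-(κ α⁻¹) * w ^ L.m j) * this +
      (κ α⁻¹ * (φ j - κ (L.value j))) * hw' - (evalTwo κ ξ (κ α) (L.S j) * w ^ L.m j) * hακ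
  have h2 : ∀ r : Polynomial K, r.eval₂ κ (κ α) = κ (r.eval α) := fun r ↦ by
    rw [Polynomial.eval₂_at_apply]
  simp only [coordinate, h1, h2, map_sub, map_sum, map_mul]
  rw [sub_add, ← Finset.sum_sub_distrib, sub_eq_add_neg, ← Finset.sum_neg_distrib]
  congr 1
  exact Finset.sum_congr rfl fun j _ ↦ by ring

lemma eval_mat_one (i j : ι) : (L.mat i j).eval 1 = (1 : Matrix ι ι K) i j := by
  simp [mat, Matrix.one_apply, apply_ite]

lemma coordinate_one (κ : K →+* B) (ξ : ι → B) (w : B) (φ : ι → B)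
    (hw : evalTwo κ ξ 1 L.denom * w = 1)
    (hφ : ∀ j, φ j * MvPolynomial.eval₂Hom κ ξ L.q ^ L.m j = MvPolynomial.eval₂Hom κ ξ (L.P j))
    (i : ι) : L.coordinate κ ξ 1 w i = φ i := by
  have := L.coordinate_of_ne_zero κ ξ w one_ne_zero φ (by simpa using hw) (by simpa using hφ) i
  rw [map_one] at this
  rw [this]
  simp [eval_mat_one, eval_center_one, Matrix.one_apply, apply_ite κ]

end LocalExpression

end Homothety

end

/-! ### Functions on schemes over `k`, affine space and its affine transformations -/

section

variable {k : Type u} [Field k]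

/-- The constant functions on a `k`-scheme. -/
def scalars {T : Scheme.{u}} (t : T ⟶ Spec (.of k)) : k →+* Γ(T, ⊤) :=
  t.appTop.hom.comp (Scheme.ΓSpecIso (.of k)).inv.hom

lemma appTop_comp_scalars {T T' : Scheme.{u}} (g : T' ⟶ T) (t : T ⟶ Spec (.of k)) :
    g.appTop.hom.comp (scalars t) = scalars (g ≫ t) := by
  rw [scalars, scalars, Scheme.Hom.comp_appTop, CommRingCat.hom_comp, RingHom.comp_assoc]

lemma appTop_scalars {T T' : Scheme.{u}} (g : T' ⟶ T) (t : T ⟶ Spec (.of k)) (c : k) :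
    g.appTop.hom (scalars t c) = scalars (g ≫ t) c :=
  congrArg (fun φ : k →+* _ ↦ φ c) (appTop_comp_scalars g t)

lemma range_subset_range_basicOpen_ι {T Y : Scheme.{u}} (f : T ⟶ Y) (s : Γ(Y, ⊤))
    (h : IsUnit (f.appTop.hom s)) : Set.range f ⊆ Set.range (Y.basicOpen s).ι := by
  have h1 : f ⁻¹ᵁ Y.basicOpen s = ⊤ := by
    rw [Scheme.preimage_basicOpen]
    exact T.basicOpen_of_isUnit h
  rintro _ ⟨x, rfl⟩
  rw [Scheme.Opens.range_ι]
  exact h1.ge (Set.mem_univ x)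

lemma isUnit_appTop_basicOpen_ι {Y : Scheme.{u}} (s : Γ(Y, ⊤)) :
    IsUnit ((Y.basicOpen s).ι.appTop.hom s) := by
  have h1 : IsUnit (Y.presheaf.map (homOfLE (Y.basicOpen_le s)).op s) :=
    Y.toRingedSpace.isUnit_res_basicOpen s
  have h2 : (Y.basicOpen s).ι.appTop ≫ (Y.basicOpen s).topIso.hom =
      Y.presheaf.map (homOfLE (Y.basicOpen_le s)).op := by
    simp only [Scheme.Opens.ι_appTop, Scheme.Opens.topIso_hom]
    exact (Functor.map_comp _ _ _).symm.trans (congrArg _ (Subsingleton.elim _ _))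
  rw [← h2, CommRingCat.comp_apply] at h1
  have h3 := h1.map (Y.basicOpen s).topIso.inv.hom
  rwa [← CommRingCat.comp_apply, Iso.hom_inv_id, CommRingCat.id_apply] at h3

section AffineSpace

variable {ι : Type u}

variable (k ι) in
/-- Affine space over `k`. -/
abbrev AffSp : Scheme.{u} := AffineSpace ι (Spec (.of k))

variable (k ι) in
/-- The structure morphism of affine space. -/
abbrev AffSp.hom : AffSp k ι ⟶ Spec (.of k) := AffSp k ι ↘ Spec (.of k)

/-- A polynomial, as a function on affine space. -/
def polyFun : MvPolynomial ι k →+* Γ(AffSp k ι, ⊤) :=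
  MvPolynomial.eval₂Hom (scalars (AffSp.hom k ι)) (AffineSpace.coord _)

lemma polyFun_bijective : Function.Bijective (polyFun (k := k) (ι := ι)) := by
  have h := AffineSpace.SpecIso_hom_appTop (n := ι) (CommRingCat.of k)
  rw [← Iso.inv_comp_eq] at h
  have h' : CommRingCat.ofHom (polyFun (k := k) (ι := ι)) =
    (Scheme.ΓSpecIso _).inv ≫ (AffineSpace.SpecIso ι (.of k)).hom.appTop := h.symm
  have : IsIso (CommRingCat.ofHom (polyFun (k := k) (ι := ι))) := by
    rw [h']
    exact IsIso.comp_isIso' inferInstance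
      (inferInstanceAs (IsIso (Scheme.Γ.map (AffineSpace.SpecIso ι (.of k)).hom.op)))
  exact ConcreteCategory.bijective_of_isIso (CommRingCat.ofHom (polyFun (k := k) (ι := ι)))

lemma homOfVector_appTop_polyFun {T : Scheme.{u}} (t : T ⟶ Spec (.of k)) (ξ : ι → Γ(T, ⊤))
    (r : MvPolynomial ι k) : (AffineSpace.homOfVector t ξ).appTop.hom (polyFun r) =
      MvPolynomial.eval₂Hom (scalars t) ξ r := by
  rw [polyFun, map_eval₂Hom, appTop_comp_scalars, AffineSpace.homOfVector_over]
  congr 2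
  ext i
  exact AffineSpace.homOfVector_appTop_coord _ _ _

lemma exists_basicOpen_polyFun_le [Infinite k] (N : (AffSp k ι).Opens) [Nonempty N] :
    ∃ (q : MvPolynomial ι k) (p : ι → k), MvPolynomial.eval p q = 1 ∧
      (AffSp k ι).basicOpen (polyFun q) ≤ N := by
  obtain ⟨x⟩ := ‹Nonempty N›
  obtain ⟨_, ⟨_, ⟨s, rfl⟩, rfl⟩, hx, hN⟩ :=
    (isBasis_basicOpen (AffSp k ι)).exists_subset_of_mem_open x.2 N.2
  obtain ⟨q, rfl⟩ := polyFun_bijective.2 s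
  have hq : q ≠ 0 := by
    rintro rfl
    simp at hx
  obtain ⟨p, hp⟩ : ∃ p, MvPolynomial.eval p q ≠ 0 := by
    by_contra! h
    exact hq (MvPolynomial.funext (by simpa using h))
  -- Rescaling by a nonzero constant leaves the basic open inside `N` and achieves the value `1` at
  -- `p`.
  refine ⟨.C (MvPolynomial.eval p q)⁻¹ * q, p, by simp [hp], ?_⟩
  rw [map_mul, Scheme.basicOpen_mul]
  exact inf_le_right.trans hN

lemma exists_fraction (q : MvPolynomial ι k) (φ : Γ((AffSp k ι).basicOpen (polyFun q), ⊤)) :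
    ∃ (P : MvPolynomial ι k) (m : ℕ),
      φ * (Scheme.Opens.ι _).appTop.hom (polyFun q) ^ m =
        (Scheme.Opens.ι _).appTop.hom (polyFun P) := by
  obtain ⟨m, s, hs⟩ := IsLocalization.Away.surj (polyFun q) φ
  obtain ⟨P, rfl⟩ := polyFun_bijective.2 s
  exact ⟨P, m, hs⟩

/-- The affine transformation with linear part `M` and constant term `c`. -/
def affineMap [Fintype ι] (M : Matrix ι ι k) (c : ι → k) : AffSp k ι ⟶ AffSp k ι :=
  AffineSpace.homOfVector (AffSp.hom k ι) fun i ↦ scalars (AffSp.hom k ι) (c i) +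
    ∑ j, scalars (AffSp.hom k ι) (M i j) * AffineSpace.coord _ j

lemma comp_affineMap_appTop [Fintype ι] {T : Scheme.{u}} (t : T ⟶ Spec (.of k))
    (g : T ⟶ AffSp k ι) (hg : g ≫ AffSp.hom k ι = t) (M : Matrix ι ι k) (c : ι → k) (i : ι) :
    (g ≫ affineMap M c).appTop.hom (AffineSpace.coord _ i) =
      scalars t (c i) + ∑ j, scalars t (M i j) * g.appTop.hom (AffineSpace.coord _ j) := by
  have : (affineMap M c).appTop.hom (AffineSpace.coord _ i) = _ :=
    AffineSpace.homOfVector_appTop_coord _ _ _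
  rw [Scheme.Hom.comp_appTop, CommRingCat.hom_comp, RingHom.comp_apply, this]
  simp only [map_add, map_sum, map_mul, appTop_scalars, hg]

lemma affineMap_over [Fintype ι] (M : Matrix ι ι k) (c : ι → k) :
    affineMap M c ≫ AffSp.hom k ι = AffSp.hom k ι :=
  AffineSpace.homOfVector_over _ _

lemma affineMap_comp [Fintype ι] (M M' : Matrix ι ι k) (c c' : ι → k) :
    affineMap M c ≫ affineMap M' c' = affineMap (M' * M) (c' + M'.mulVec c) := by
  refine AffineSpace.hom_ext (by simp [affineMap_over]) fun i ↦ ?_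
  have h1 := comp_affineMap_appTop _ _ (affineMap_over M c) M' c' i
  have h2 := comp_affineMap_appTop _ _ (Category.id_comp _) (M' * M) (c' + M'.mulVec c) i
  have h3 := fun j ↦ comp_affineMap_appTop _ _ (Category.id_comp _) M c j
  rw [Category.id_comp] at h2
  simp only [Category.id_comp] at h3
  refine h1.trans (Eq.trans ?_ h2.symm)
  simp only [h3]
  simp only [Pi.add_apply, Matrix.mulVec, dotProduct, map_add, map_sum, map_mul, Matrix.mul_apply,
    mul_add, Finset.sum_add_distrib, Finset.mul_sum, Finset.sum_mul, add_assoc]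
  congr 2
  rw [Finset.sum_comm]
  exact Finset.sum_congr rfl fun j _ ↦ Finset.sum_congr rfl fun l _ ↦ by ring

lemma affineMap_one [Fintype ι] [DecidableEq ι] : affineMap (1 : Matrix ι ι k) 0 = 𝟙 _ := by
  refine AffineSpace.hom_ext (by simp [affineMap_over]) fun i ↦ ?_
  have h3 := comp_affineMap_appTop _ _ (Category.id_comp _) (1 : Matrix ι ι k) 0 i
  rw [Category.id_comp] at h3
  refine h3.trans ?_
  simp [Matrix.one_apply, apply_ite]

lemma isIso_affineMap [Fintype ι] [DecidableEq ι] {M : Matrix ι ι k} (hM : IsUnit M) (c : ι → k) :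
    IsIso (affineMap M c) := by
  have hd := (Matrix.isUnit_iff_isUnit_det _).1 hM
  refine ⟨affineMap M⁻¹ (- M⁻¹.mulVec c), ?_, ?_⟩
  · rw [affineMap_comp, Matrix.nonsing_inv_mul _ hd, neg_add_cancel, affineMap_one]
  · rw [affineMap_comp, Matrix.mul_nonsing_inv _ hd, Matrix.mulVec_neg, Matrix.mulVec_mulVec,
      Matrix.mul_nonsing_inv _ hd, Matrix.one_mulVec, add_neg_cancel, affineMap_one]

end AffineSpace

end

/-! ### Fractions on basic opens, and invertibility of the Jacobian via dual numbers -/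

section

variable {k : Type u} [Field k] {ι : Type u}

/-- The morphism to the complement of a hypersurface given by its coordinates. -/
def toBasicOpen {T : Scheme.{u}} (t : T ⟶ Spec (.of k)) (ξ : ι → Γ(T, ⊤)) (q : MvPolynomial ι k)
    (h : IsUnit (MvPolynomial.eval₂Hom (scalars t) ξ q)) :
    T ⟶ ((AffSp k ι).basicOpen (polyFun q)).toScheme :=
  IsOpenImmersion.lift (Scheme.Opens.ι _) (AffineSpace.homOfVector t ξ)
    (range_subset_range_basicOpen_ι _ _ (by rwa [homOfVector_appTop_polyFun]))

lemma toBasicOpen_ι {T : Scheme.{u}} (t : T ⟶ Spec (.of k)) (ξ : ι → Γ(T, ⊤))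
    (q : MvPolynomial ι k) (h : IsUnit (MvPolynomial.eval₂Hom (scalars t) ξ q)) :
    toBasicOpen t ξ q h ≫ Scheme.Opens.ι _ = AffineSpace.homOfVector t ξ :=
  IsOpenImmersion.lift_fac _ _ _

/-- The morphism `f`, defined on the complement of `q = 0`, is given by the fractions
`P j / q ^ m j`. -/
structure IsFraction {q : MvPolynomial ι k} (P : ι → MvPolynomial ι k) (m : ι → ℕ)
    (f : ((AffSp k ι).basicOpen (polyFun q)).toScheme ⟶ AffSp k ι) : Prop where
  comp_hom : f ≫ AffSp.hom k ι = Scheme.Opens.ι _ ≫ AffSp.hom k ι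
  mul_eq (j : ι) : f.appTop.hom (AffineSpace.coord _ j) *
    (Scheme.Opens.ι _).appTop.hom (polyFun q) ^ m j = (Scheme.Opens.ι _).appTop.hom (polyFun (P j))

lemma exists_isFraction {q : MvPolynomial ι k}
    (f : ((AffSp k ι).basicOpen (polyFun q)).toScheme ⟶ AffSp k ι)
    (hf : f ≫ AffSp.hom k ι = Scheme.Opens.ι _ ≫ AffSp.hom k ι) :
    ∃ (P : ι → MvPolynomial ι k) (m : ι → ℕ), IsFraction P m f := by
  choose P m h using fun j ↦ exists_fraction q (f.appTop.hom (AffineSpace.coord _ j))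
  exact ⟨P, m, hf, h⟩

lemma IsFraction.comp_mul_eq {q : MvPolynomial ι k} {P : ι → MvPolynomial ι k} {m : ι → ℕ}
    {f : ((AffSp k ι).basicOpen (polyFun q)).toScheme ⟶ AffSp k ι} (hf : IsFraction P m f)
    {T : Scheme.{u}} (t : T ⟶ Spec (.of k)) (ξ : ι → Γ(T, ⊤))
    (g : T ⟶ ((AffSp k ι).basicOpen (polyFun q)).toScheme)
    (hg : g ≫ Scheme.Opens.ι _ = AffineSpace.homOfVector t ξ) (j : ι) :
    (g ≫ f).appTop.hom (AffineSpace.coord _ j) * MvPolynomial.eval₂Hom (scalars t) ξ q ^ m j =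
      MvPolynomial.eval₂Hom (scalars t) ξ (P j) := by
  have h1 := congrArg g.appTop.hom (hf.mul_eq j)
  have h2 (r : MvPolynomial ι k) : g.appTop.hom ((Scheme.Opens.ι _).appTop.hom (polyFun r)) =
      MvPolynomial.eval₂Hom (scalars t) ξ r := by
    rw [← homOfVector_appTop_polyFun, ← hg]
    rfl
  rw [map_mul, map_pow, h2, h2] at h1
  exact h1

variable [Fintype ι] [DecidableEq ι]

lemma scalars_SpecMap {B : Type u} [CommRing B] [Algebra k B] (c : k) :
    scalars (Spec.map (CommRingCat.ofHom (algebraMap k B))) c =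
      (Scheme.ΓSpecIso (.of B)).inv.hom (algebraMap k B c) := by
  rw [scalars, ← CommRingCat.hom_comp, ← Scheme.ΓSpecIso_inv_naturality]
  rfl

/-- The Jacobian matrix of a monomorphism is invertible. -/
lemma LocalExpression.isUnit_J (L : LocalExpression k ι)
    (f : ((AffSp k ι).basicOpen (polyFun L.q)).toScheme ⟶ AffSp k ι) [Mono f]
    (hf : IsFraction L.P L.m f) : IsUnit L.J := by
  rw [← Matrix.mulVec_injective_iff_isUnit, ← Matrix.coe_mulVecLin, ← LinearMap.ker_eq_bot,
    LinearMap.ker_eq_bot']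
  intro v hv
  -- Morphisms from `Spec k[ε]` are tangent vectors, and a monomorphism is injective on them.
  let t : Spec (.of (DualNumber k)) ⟶ Spec (.of k) :=
    Spec.map (CommRingCat.ofHom (algebraMap k (DualNumber k)))
  let e := (Scheme.ΓSpecIso (.of (DualNumber k))).inv.hom
  have he : Function.Injective e :=
    (ConcreteCategory.bijective_of_isIso (Scheme.ΓSpecIso (.of (DualNumber k))).inv).1
  let η := e DualNumber.eps
  have hη : η * η = 0 := by
    rw [← map_mul, DualNumber.eps_mul_eps, map_zero]
  have hηv (c : k) (hc : η * scalars t c = 0) : c = 0 := by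
    rw [scalars_SpecMap, ← map_mul, ← map_zero e] at hc
    have h := congrArg TrivSqZeroExt.snd (he hc)
    rw [DualNumber.snd_mul] at h
    simpa [TrivSqZeroExt.algebraMap_eq_inl] using h
  let ξ (w : ι → k) (i : ι) := scalars t (L.p i) + η * scalars t (w i)
  -- The tangent vector `p + εw` is the homothety of ratio `ε` applied to `p + w`, so the expansion
  -- in `s` can be used with `s = ε`.
  have hξ (w : ι → k) : ξ w = fun i ↦ scalars t (L.p i) + η *
      ((fun i ↦ scalars t (L.p i + w i)) i - scalars t (L.p i)) := by
    ext i
    simp [ξ]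
  -- The value of `q` is `q(p) = 1` plus a multiple of the nilpotent `ε`.
  have hq (w : ι → k) : IsUnit (MvPolynomial.eval₂Hom (scalars t) (ξ w) L.q) := by
    rw [hξ, ← evalTwo_homothety, ← Polynomial.X_mul_divX_add (homothety L.p L.q),
      (homothety_coeff _ _).1, L.eval_q]
    have h1 : evalTwo (scalars t) (fun i ↦ scalars t (L.p i + w i)) η Polynomial.X = η := by
      simp [evalTwo]
    have h2 : evalTwo (scalars t) (fun i ↦ scalars t (L.p i + w i)) η
        (Polynomial.C (MvPolynomial.C 1)) = 1 := by
      simp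
    rw [map_add, map_mul, h1, h2]
    exact IsNilpotent.isUnit_add_one ⟨2, by rw [mul_pow, pow_two, hη, zero_mul]⟩
  -- As `ε² = 0`, only the linear term `ε J w` survives. For `w` in the kernel of `J`, the tangent
  -- vector is thus sent to the constant `f(p)`, independently of `w`.
  have hfw (w : ι → k) (hw : L.J.mulVec w = 0) (j : ι) :
      (toBasicOpen t (ξ w) L.q (hq w) ≫ f).appTop.hom (AffineSpace.coord _ j) =
        scalars t (L.value j) := by
    have h1 := hf.comp_mul_eq t (ξ w) _ (toBasicOpen_ι t (ξ w) L.q (hq w)) j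
    have h2 := congrArg (evalTwo (scalars t) (fun i ↦ scalars t (L.p i + w i)) η)
      (L.homothety_eq j)
    rw [evalTwo_homothety, ← hξ, map_mul, map_sub, map_mul, map_pow] at h2
    have h3 : evalTwo (scalars t) (fun i ↦ scalars t (L.p i + w i)) η Polynomial.X = η := by
      simp [evalTwo]
    have h4 : MvPolynomial.eval₂Hom (scalars t)
        (fun i ↦ scalars t (L.p i + w i)) ((L.S j).coeff 0) = scalars t (L.J.mulVec w j) := by
      rw [L.coeff_S]
      simp [Matrix.mulVec, dotProduct]
    rw [h3, mul_evalTwo_of_mul_self_eq_zero _ _ hη, h4, hw, Pi.zero_apply, map_zero, mul_zero,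
      sub_eq_zero, ← h1] at h2
    have := ((hq w).pow (L.m j)).mul_right_cancel h2
    rw [this]
    simp [value]
  have hcomp (w : ι → k) (hw : L.J.mulVec w = 0) : toBasicOpen t (ξ w) L.q (hq w) =
      toBasicOpen t (ξ 0) L.q (hq 0) := by
    rw [← cancel_mono f]
    refine AffineSpace.hom_ext ?_ fun j ↦ ?_
    · rw [Category.assoc, Category.assoc, hf.comp_hom, reassoc_of% toBasicOpen_ι,
        reassoc_of% toBasicOpen_ι,
        AffineSpace.homOfVector_over, AffineSpace.homOfVector_over]
    · exact (hfw w hw j).trans (hfw 0 (Matrix.mulVec_zero _) j).symm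
  ext i
  refine hηv _ ?_
  have h1 := congrArg (· ≫ Scheme.Opens.ι _) (hcomp v hv)
  simp only [toBasicOpen_ι] at h1
  have h2 := congrArg (fun g ↦ g.appTop.hom (AffineSpace.coord _ i)) h1
  have h3 (w : ι → k) : (AffineSpace.homOfVector t (ξ w)).appTop.hom (AffineSpace.coord _ i) =
      ξ w i := AffineSpace.homOfVector_appTop_coord _ _ _
  simp only [h3] at h2
  simpa [ξ] using h2

end

/-! ### Rational points of the line, and the family over an open of the line -/

section

variable {k : Type u} [Field k] {ι : Type u}

section Line

/-- A polynomial in one variable, as a function on the affine line. -/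
def lineFun (d : Polynomial k) : Γ(AffineLine k, ⊤) :=
  d.eval₂ (scalars (AffineLine.hom k)) (AffineSpace.coord _ PUnit.unit)

/-- The complement of the zeros of a polynomial in the affine line. -/
def lineOpen (d : Polynomial k) : (AffineLine k).Opens := (AffineLine k).basicOpen (lineFun d)

lemma appTop_lineFun {T : Scheme.{u}} (t : T ⟶ Spec (.of k)) (g : T ⟶ AffineLine k)
    (hg : g ≫ AffineLine.hom k = t) (d : Polynomial k) :
    g.appTop.hom (lineFun d) =
      d.eval₂ (scalars t) (g.appTop.hom (AffineSpace.coord _ PUnit.unit)) := by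
  rw [lineFun, Polynomial.hom_eval₂, appTop_comp_scalars, hg]

lemma scalars_id_bijective : Function.Bijective (scalars (𝟙 (Spec (.of k)))) := by
  have : scalars (𝟙 (Spec (.of k))) = (Scheme.ΓSpecIso (.of k)).inv.hom := by
    ext x
    simp [scalars]
  rw [this]
  exact ConcreteCategory.bijective_of_isIso (Scheme.ΓSpecIso (.of k)).inv

/-- The point of the affine line with coordinate `c`. -/
def linePoint (c : k) : Spec (.of k) ⟶ AffineLine k :=
  AffineSpace.homOfVector (𝟙 _) fun _ ↦ scalars (𝟙 _) c

lemma linePoint_zero : linePoint (0 : k) = AffineLine.zero k := by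
  simp [linePoint, AffineLine.zero]

lemma linePoint_one : linePoint (1 : k) = AffineLine.one k := by
  simp [linePoint, AffineLine.one]

lemma linePoint_over (c : k) : linePoint c ≫ AffineLine.hom k = 𝟙 _ :=
  AffineSpace.homOfVector_over _ _

lemma linePoint_appTop_coord (c : k) :
    (linePoint c).appTop.hom (AffineSpace.coord _ PUnit.unit) = scalars (𝟙 _) c :=
  AffineSpace.homOfVector_appTop_coord _ _ _

lemma exists_point_lineOpen (d : Polynomial k) (c : k) (hc : d.eval c ≠ 0) :
    ∃ a : Points ((lineOpen d).ι ≫ AffineLine.hom k), a.1 ≫ (lineOpen d).ι = linePoint c := by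
  have hu : IsUnit ((linePoint c).appTop.hom (lineFun d)) := by
    rw [appTop_lineFun _ _ (linePoint_over c), linePoint_appTop_coord, Polynomial.eval₂_at_apply]
    exact (Ne.isUnit hc).map _
  have h := IsOpenImmersion.lift_fac (lineOpen d).ι (linePoint c)
    (range_subset_range_basicOpen_ι _ _ hu)
  exact ⟨⟨_, (Category.assoc _ _ _).symm.trans
    ((congrArg (· ≫ AffineLine.hom k) h).trans (linePoint_over c))⟩, h⟩

lemma exists_coordinate (U : (AffineLine k).Opens) (a : Points (U.ι ≫ AffineLine.hom k)) :
    ∃ α : k, a.1 ≫ U.ι = linePoint α := by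
  obtain ⟨α, hα⟩ := scalars_id_bijective.2
    ((a.1 ≫ U.ι).appTop.hom (AffineSpace.coord _ PUnit.unit))
  refine ⟨α, AffineSpace.hom_ext ?_ fun i ↦ ?_⟩
  · exact (Category.assoc _ _ _).trans (a.2.trans (linePoint_over α).symm)
  · exact hα.symm.trans (linePoint_appTop_coord α).symm

lemma eval_ne_zero_of_comp_eq {d : Polynomial k} {a : Spec (.of k) ⟶ lineOpen d} {α : k}
    (h : a ≫ (lineOpen d).ι = linePoint α) : d.eval α ≠ 0 := by
  intro h0
  have h1 : IsUnit ((linePoint α).appTop.hom (lineFun d)) := by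
    rw [← h]
    exact (isUnit_appTop_basicOpen_ι (lineFun d)).map a.appTop.hom
  rw [appTop_lineFun _ _ (linePoint_over α), linePoint_appTop_coord, Polynomial.eval₂_at_apply,
    h0, map_zero] at h1
  have : Nontrivial Γ(Spec (CommRingCat.of k), ⊤) :=
    scalars_id_bijective.1.nontrivial
  exact not_isUnit_zero h1

end Line

section Family

variable (U : (AffineLine k).Opens)

namespace LocalExpression

/-- The product of an open subscheme of the affine line and an affine space. -/
abbrev total : Scheme.{u} := pullback (U.ι ≫ AffineLine.hom k) (AffSp.hom k ι)

variable (ι) in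
/-- The structure morphism of the product. -/
abbrev total.hom : total (ι := ι) U ⟶ Spec (.of k) :=
  pullback.snd (U.ι ≫ AffineLine.hom k) (AffSp.hom k ι) ≫ AffSp.hom k ι

variable (ι) in
/-- The parameter, as a function on the product. -/
def param : Γ(total (ι := ι) U, ⊤) :=
  (pullback.fst (U.ι ≫ AffineLine.hom k) (AffSp.hom k ι) ≫ U.ι).appTop.hom
    (AffineSpace.coord _ PUnit.unit)

/-- The coordinates of the affine space, as functions on the product. -/
def coords (i : ι) : Γ(total (ι := ι) U, ⊤) :=
  (pullback.snd (U.ι ≫ AffineLine.hom k) (AffSp.hom k ι)).appTop.hom (AffineSpace.coord _ i)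

variable {U} (a : Points (U.ι ≫ AffineLine.hom k)) {α : k}

lemma fiberInclusion_over :
    fiberInclusion (AffSp.hom k ι) a ≫ total.hom ι U = AffSp.hom k ι := by
  rw [← Category.assoc, fiberInclusion_snd, Category.id_comp]

lemma fiberInclusion_coords (i : ι) :
    (fiberInclusion (AffSp.hom k ι) a).appTop.hom (coords U i) = AffineSpace.coord _ i := by
  have : (fiberInclusion (AffSp.hom k ι) a ≫ pullback.snd _ _).appTop.hom
      (AffineSpace.coord _ i) = AffineSpace.coord _ i := by
    rw [fiberInclusion_snd]
    simp
  exact this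

lemma fiberInclusion_param (hα : a.1 ≫ U.ι = linePoint α) :
    (fiberInclusion (AffSp.hom k ι) a).appTop.hom (param ι U) = scalars (AffSp.hom k ι) α := by
  have h : (fiberInclusion (AffSp.hom k ι) a ≫ pullback.fst _ _ ≫ U.ι).appTop.hom
      (AffineSpace.coord _ PUnit.unit) = scalars (AffSp.hom k ι) α := by
    rw [reassoc_of% fiberInclusion_fst, hα]
    refine (congrArg (AffSp.hom k ι).appTop.hom (linePoint_appTop_coord α)).trans ?_
    rw [appTop_scalars, Category.comp_id]
  exact h

variable [Fintype ι] (L : LocalExpression k ι) (U)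

/-- The denominator, as a function on the product. -/
def denomFun : Γ(total (ι := ι) U, ⊤) :=
  evalTwo (scalars (total.hom ι U)) (coords U) (param ι U) L.denom

/-- The domain of the family. -/
def domain : (total (ι := ι) U).Opens := (total U).basicOpen (L.denomFun U)

lemma isUnit_denomFun : IsUnit ((L.domain U).ι.appTop.hom (L.denomFun U)) :=
  isUnit_appTop_basicOpen_ι (L.denomFun U)

/-- The inverse of the denominator on the domain of the family. -/
def invDenom : Γ((L.domain U).toScheme, ⊤) :=
  ((L.isUnit_denomFun U).unit⁻¹ : _ˣ)

lemma denomFun_mul_invDenom :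
    (L.domain U).ι.appTop.hom (L.denomFun U) * L.invDenom U = 1 :=
  (L.isUnit_denomFun U).mul_val_inv

section

variable [DecidableEq ι]

/-- The family of maps `x ↦ center s + mat s * (f (p + s (x - p)) - f p) / s`. -/
def family : (L.domain U).toScheme ⟶ AffSp k ι :=
  AffineSpace.homOfVector ((L.domain U).ι ≫ total.hom ι U) fun i ↦
    L.coordinate (scalars ((L.domain U).ι ≫ total.hom ι U))
      (fun i ↦ (L.domain U).ι.appTop.hom (coords U i)) ((L.domain U).ι.appTop.hom (param ι U))
      (L.invDenom U) i

lemma family_over : L.family U ≫ AffSp.hom k ι = (L.domain U).ι ≫ total.hom ι U :=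
  AffineSpace.homOfVector_over _ _

end

variable {U}

/-- The domain of the fibre of the family over a point. -/
abbrev fiberDomain : (AffSp k ι).Opens := fiberInclusion (AffSp.hom k ι) a ⁻¹ᵁ L.domain U

/-- The structure morphism of the domain of a fibre. -/
abbrev fiberHom : (L.fiberDomain a).toScheme ⟶ Spec (.of k) :=
  (L.fiberDomain a).ι ≫ AffSp.hom k ι

/-- The coordinates on the domain of a fibre. -/
abbrev fiberCoord (i : ι) : Γ((L.fiberDomain a).toScheme, ⊤) :=
  (L.fiberDomain a).ι.appTop.hom (AffineSpace.coord _ i)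

/-- The fibre of the family over a point. -/
abbrev fiberMap [DecidableEq ι] : (L.fiberDomain a).toScheme ⟶ AffSp k ι :=
  fiberInclusion (AffSp.hom k ι) a ∣_ L.domain U ≫ L.family U

lemma fiberInclusion_denomFun (hα : a.1 ≫ U.ι = linePoint α) :
    (fiberInclusion (AffSp.hom k ι) a).appTop.hom (L.denomFun U) =
      evalTwo (scalars (AffSp.hom k ι)) (AffineSpace.coord _) (scalars (AffSp.hom k ι) α)
        L.denom := by
  rw [denomFun, map_evalTwo, appTop_comp_scalars, fiberInclusion_over, fiberInclusion_param a hα]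
  congr 2
  ext i
  exact fiberInclusion_coords a i

lemma restrict_appTop (s : Γ(total (ι := ι) U, ⊤)) :
    (fiberInclusion (AffSp.hom k ι) a ∣_ L.domain U).appTop.hom ((L.domain U).ι.appTop.hom s) =
    (L.fiberDomain a).ι.appTop.hom ((fiberInclusion (AffSp.hom k ι) a).appTop.hom s) := by
  have := congrArg (fun g ↦ g.appTop.hom s)
    (morphismRestrict_ι (fiberInclusion (AffSp.hom k ι) a) (L.domain U))
  exact this

/-- Reduces every statement about the fibre at `α` to the ring identities for `coordinate`. Of `w`,
the restricted inverse of the denominator, only the defining equation matters. -/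
lemma exists_fiberMap_appTop [DecidableEq ι] (hα : a.1 ≫ U.ι = linePoint α) :
    ∃ w, evalTwo (scalars (L.fiberHom a)) (L.fiberCoord a) (scalars (L.fiberHom a) α) L.denom * w
      = 1 ∧ ∀ i, (L.fiberMap a).appTop.hom (AffineSpace.coord _ i) =
        L.coordinate (scalars (L.fiberHom a)) (L.fiberCoord a) (scalars (L.fiberHom a) α) w i := by
  refine ⟨(fiberInclusion (AffSp.hom k ι) a ∣_ L.domain U).appTop.hom (L.invDenom U), ?_, ?_⟩
  · have h := congrArg (fiberInclusion (AffSp.hom k ι) a ∣_ L.domain U).appTop.hom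
      (L.denomFun_mul_invDenom U)
    rw [map_mul, map_one, restrict_appTop, L.fiberInclusion_denomFun a hα, map_evalTwo,
      appTop_comp_scalars, appTop_scalars] at h
    exact h
  · intro i
    have h : (L.family U).appTop.hom (AffineSpace.coord _ i) = _ :=
      AffineSpace.homOfVector_appTop_coord _ _ _
    rw [Scheme.Hom.comp_appTop, CommRingCat.hom_comp, RingHom.comp_apply, h, map_coordinate,
      appTop_comp_scalars, restrict_appTop, fiberInclusion_param a hα, appTop_scalars,
      morphismRestrict_ι_assoc, fiberInclusion_over]
    have hc : (fiberInclusion (AffSp.hom k ι) a ∣_ L.domain U).appTop.hom ∘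
        (fun i ↦ (L.domain U).ι.appTop.hom (coords U i)) = L.fiberCoord a :=
      funext fun i ↦ (L.restrict_appTop a _).trans (congrArg _ (fiberInclusion_coords a i))
    rw [hc]

end LocalExpression
end Family

end

/-! ### Fibres of the family: identity at `0`, `f` at `1`, open immersions throughout -/

section

variable {k : Type u} [Field k] {ι : Type u} [Fintype ι]

namespace LocalExpression

variable (L : LocalExpression k ι) {U : (AffineLine k).Opens}
  (a : Points (U.ι ≫ AffineLine.hom k)) {α : k}

/-- The point `p` lies in every fibre domain: each homothety fixes it, and `q(p) = 1`. -/
lemma fiberDomain_nonempty : Nonempty (L.fiberDomain a) := by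
  obtain ⟨α, hα⟩ := exists_coordinate U a
  have h1 : IsUnit ((AffineSpace.homOfVector (𝟙 (Spec (.of k)))
      (fun i ↦ scalars (𝟙 _) (L.p i))).appTop.hom
      ((fiberInclusion (AffSp.hom k ι) a).appTop.hom (L.denomFun U))) := by
    rw [L.fiberInclusion_denomFun a hα, map_evalTwo, appTop_comp_scalars, appTop_scalars,
      AffineSpace.homOfVector_over]
    have h2 : (AffineSpace.homOfVector (𝟙 (Spec (.of k)))
      (fun i ↦ scalars (𝟙 _) (L.p i))).appTop.hom ∘ AffineSpace.coord _ =
        fun i ↦ scalars (𝟙 _) (L.p i) :=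
      funext fun i ↦ AffineSpace.homOfVector_appTop_coord _ _ _
    rw [h2, evalTwo_denom]
    simp only [sub_self, mul_zero, add_zero, eval₂Hom_comp, L.eval_q, map_one, isUnit_one]
  have h3 := range_subset_range_basicOpen_ι _ _ h1
  rw [Scheme.Opens.range_ι, ← Scheme.preimage_basicOpen_top] at h3
  exact ⟨⟨_, h3 ⟨IsLocalRing.closedPoint k, rfl⟩⟩⟩

variable [DecidableEq ι]

lemma fiberMap_over : L.fiberMap a ≫ AffSp.hom k ι = L.fiberHom a := by
  rw [Category.assoc, family_over, morphismRestrict_ι_assoc, fiberInclusion_over]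

lemma fiberMap_of_eq_zero (hJ : IsUnit L.J) (ha : a.1 ≫ U.ι = linePoint 0) :
    L.fiberMap a = (L.fiberDomain a).ι := by
  obtain ⟨w, hw, h⟩ := L.exists_fiberMap_appTop a ha
  refine AffineSpace.hom_ext (L.fiberMap_over a) fun i ↦ (h i).trans ?_
  rw [map_zero] at hw ⊢
  exact L.coordinate_zero hJ _ _ w hw i

variable (f : ((AffSp k ι).basicOpen (polyFun L.q)).toScheme ⟶ AffSp k ι)

/-- At `s = 1` the homothety is the identity, so the inverted denominator is `L.q` itself. The fibre
domain therefore lies in the domain of `f`, and `l` is the inclusion. -/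
lemma fiberMap_of_eq_one (hf : IsFraction L.P L.m f) (ha : a.1 ≫ U.ι = linePoint 1) :
    ∃ l : (L.fiberDomain a).toScheme ⟶ (AffSp k ι).basicOpen (polyFun L.q),
      l ≫ Scheme.Opens.ι _ = (L.fiberDomain a).ι ∧ l ≫ f = L.fiberMap a := by
  obtain ⟨w, hw, h⟩ := L.exists_fiberMap_appTop a ha
  rw [map_one] at hw
  have hu : IsUnit (MvPolynomial.eval₂Hom (scalars (L.fiberHom a)) (L.fiberCoord a) L.q) := by
    refine IsUnit.of_mul_eq_one w ?_
    simpa [evalTwo_denom] using hw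
  have hι : AffineSpace.homOfVector (L.fiberHom a) (L.fiberCoord a) = (L.fiberDomain a).ι :=
    AffineSpace.hom_ext (AffineSpace.homOfVector_over _ _) fun i ↦
      AffineSpace.homOfVector_appTop_coord _ _ _
  refine ⟨toBasicOpen _ _ _ hu, (toBasicOpen_ι _ _ _ hu).trans hι, ?_⟩
  refine AffineSpace.hom_ext ?_ fun i ↦ Eq.trans ?_ (h i).symm
  · rw [fiberMap_over, Category.assoc, hf.comp_hom, reassoc_of% toBasicOpen_ι,
      AffineSpace.homOfVector_over]
  · rw [map_one]
    exact (L.coordinate_one _ _ w _ hw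
      (hf.comp_mul_eq _ _ _ (toBasicOpen_ι _ _ _ hu)) i).symm

/-- The fibre is a homothety of ratio `α`, then `f`, then an affine map with linear part `mat α /
α`. Both affine maps are invertible under the two nonvanishing hypotheses. -/
lemma isOpenImmersion_fiberMap_of_ne_zero [IsOpenImmersion f] (hf : IsFraction L.P L.m f)
    (ha : a.1 ≫ U.ι = linePoint α) (hα : α ≠ 0) (hdet : L.mat.det.eval α ≠ 0) :
    IsOpenImmersion (L.fiberMap a) := by
  obtain ⟨w, hw, h⟩ := L.exists_fiberMap_appTop a ha
  let τ (i : ι) := scalars (L.fiberHom a) (L.p i) + scalars (L.fiberHom a) α *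
    (L.fiberCoord a i - scalars (L.fiberHom a) (L.p i))
  have hu : IsUnit (MvPolynomial.eval₂Hom (scalars (L.fiberHom a)) τ L.q) := by
    refine IsUnit.of_mul_eq_one w ?_
    rwa [evalTwo_denom] at hw
  have hτ : AffineSpace.homOfVector (L.fiberHom a) τ = (L.fiberDomain a).ι ≫
      affineMap (α • (1 : Matrix ι ι k)) (fun i ↦ L.p i - α * L.p i) := by
    refine AffineSpace.hom_ext ?_ fun i ↦ ?_
    · rw [AffineSpace.homOfVector_over, Category.assoc, affineMap_over]
    · refine (AffineSpace.homOfVector_appTop_coord _ _ _).trans (Eq.trans ?_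
        (comp_affineMap_appTop (L.fiberHom a) (L.fiberDomain a).ι rfl _ _ i).symm)
      simp only [τ, map_sub, map_mul, Matrix.smul_apply, Matrix.one_apply, smul_eq_mul, mul_ite,
        mul_one, mul_zero, apply_ite (scalars (L.fiberHom a)), map_zero, ite_mul, zero_mul,
        Finset.sum_ite_eq, Finset.mem_univ, if_true]
      ring
  have hg : IsOpenImmersion (toBasicOpen _ _ _ hu) := by
    have h1 : IsOpenImmersion (toBasicOpen _ _ _ hu ≫ Scheme.Opens.ι _) := by
      rw [toBasicOpen_ι, hτ]
      have := isIso_affineMap (M := α • (1 : Matrix ι ι k))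
        ((Matrix.isUnit_iff_isUnit_det _).2 (by simp [hα])) (fun i ↦ L.p i - α * L.p i)
      infer_instance
    exact IsOpenImmersion.of_comp _ (Scheme.Opens.ι _)
  have hM : IsUnit (Matrix.of fun i j ↦ (L.mat i j).eval α * α⁻¹) := by
    have h1 : (Matrix.of fun i j ↦ (L.mat i j).eval α * α⁻¹) =
        α⁻¹ • L.mat.map (Polynomial.evalRingHom α) := by
      ext i j
      simp [mul_comm]
    rw [h1, Matrix.isUnit_iff_isUnit_det, Matrix.det_smul, ← RingHom.mapMatrix_apply,
      ← RingHom.map_det]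
    exact (Ne.isUnit (pow_ne_zero _ (inv_ne_zero hα))).mul (Ne.isUnit hdet)
  have key : L.fiberMap a = (toBasicOpen _ _ _ hu ≫ f) ≫
      affineMap (Matrix.of fun i j ↦ (L.mat i j).eval α * α⁻¹)
        (fun i ↦ (L.center i).eval α - ∑ j, (L.mat i j).eval α * α⁻¹ * L.value j) := by
    have hover : (toBasicOpen _ _ _ hu ≫ f) ≫ AffSp.hom k ι = L.fiberHom a := by
      rw [Category.assoc, hf.comp_hom, reassoc_of% toBasicOpen_ι, AffineSpace.homOfVector_over]
    refine AffineSpace.hom_ext ?_ fun i ↦ (h i).trans (Eq.trans ?_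
      (comp_affineMap_appTop _ _ hover _ _ i).symm)
    · rw [fiberMap_over, Category.assoc, affineMap_over, hover]
    · exact L.coordinate_of_ne_zero _ _ w hα _ hw
        (hf.comp_mul_eq _ _ _ (toBasicOpen_ι _ _ _ hu)) i
  have := isIso_affineMap hM
    (fun i ↦ (L.center i).eval α - ∑ j, (L.mat i j).eval α * α⁻¹ * L.value j)
  rw [key]
  infer_instance

lemma isOpenImmersion_fiberMap [IsOpenImmersion f] (hf : IsFraction L.P L.m f)
    (a : Points ((lineOpen L.mat.det).ι ≫ AffineLine.hom k)) : IsOpenImmersion (L.fiberMap a) := by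
  obtain ⟨α, hα⟩ := exists_coordinate _ a
  by_cases h : α = 0
  · subst h
    rw [L.fiberMap_of_eq_zero a (L.isUnit_J f hf) hα]
    infer_instance
  · exact L.isOpenImmersion_fiberMap_of_ne_zero a f hf hα h (eval_ne_zero_of_comp_eq hα)

lemma det_mat_eval_one : L.mat.det.eval 1 = 1 := by
  have h : L.mat.map (Polynomial.evalRingHom 1) = 1 := by
    ext i j
    exact L.eval_mat_one i j
  rw [← Polynomial.coe_evalRingHom, RingHom.map_det, RingHom.mapMatrix_apply, h, Matrix.det_one]

lemma det_mat_eval_zero (hJ : IsUnit L.J) : L.mat.det.eval 0 ≠ 0 := by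
  have h : L.mat.map (Polynomial.evalRingHom 0) = L.J⁻¹ := by
    ext i j
    simp [mat]
  rw [← Polynomial.coe_evalRingHom, RingHom.map_det, RingHom.mapMatrix_apply, h,
    ← isUnit_iff_ne_zero, ← Matrix.isUnit_iff_isUnit_det]
  exact Matrix.isUnit_nonsing_inv_iff.2 hJ

end LocalExpression

/-- An open immersion from a nonempty open subscheme of an affine space to this affine space fits
into a family, parametrised by an open subscheme of the affine line, of open immersions from
nonempty open subschemes, which contains the identity. -/
theorem exists_family_through [Infinite k] (N : (AffSp k ι).Opens) [Nonempty N]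
    (f : N.toScheme ⟶ AffSp k ι) [IsOpenImmersion f]
    (hf : f ≫ AffSp.hom k ι = N.ι ≫ AffSp.hom k ι) :
    ∃ (U : (AffineLine k).Opens) (V : (pullback (U.ι ≫ AffineLine.hom k) (AffSp.hom k ι)).Opens)
      (h : V.toScheme ⟶ AffSp k ι) (p₀ p₁ : Points (U.ι ≫ AffineLine.hom k)),
      p₀.1 ≫ U.ι = AffineLine.zero k ∧ p₁.1 ≫ U.ι = AffineLine.one k ∧
      h ≫ AffSp.hom k ι = V.ι ≫ pullback.snd _ _ ≫ AffSp.hom k ι ∧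
      (∀ a : Points (U.ι ≫ AffineLine.hom k),
        Nonempty (fiberInclusion (AffSp.hom k ι) a ⁻¹ᵁ V) ∧
        IsOpenImmersion (fiberInclusion (AffSp.hom k ι) a ∣_ V ≫ h)) ∧
      fiberInclusion (AffSp.hom k ι) p₀ ∣_ V ≫ h =
        (fiberInclusion (AffSp.hom k ι) p₀ ⁻¹ᵁ V).ι ∧
      ∃ l : (fiberInclusion (AffSp.hom k ι) p₁ ⁻¹ᵁ V).toScheme ⟶ N,
        l ≫ N.ι = (fiberInclusion (AffSp.hom k ι) p₁ ⁻¹ᵁ V).ι ∧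
        l ≫ f = fiberInclusion (AffSp.hom k ι) p₁ ∣_ V ≫ h := by
  classical
  obtain ⟨q, p, hpq, hqN⟩ := exists_basicOpen_polyFun_le N
  obtain ⟨P, m, hfrac⟩ := exists_isFraction (Scheme.homOfLE _ hqN ≫ f) (by simp [hf])
  obtain ⟨L, -, rfl, rfl, rfl⟩ := LocalExpression.exists_of_eval_eq_one p q P m hpq
  have hJ := L.isUnit_J _ hfrac
  -- The parameters `0` and `1` are allowed because the matrix is `J⁻¹` at `0` and the identity at
  -- `1`.
  obtain ⟨p₀, h₀⟩ := exists_point_lineOpen L.mat.det 0 (L.det_mat_eval_zero hJ)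
  obtain ⟨p₁, h₁⟩ := exists_point_lineOpen L.mat.det 1
    (by rw [L.det_mat_eval_one]; exact one_ne_zero)
  obtain ⟨l, hl, hlf⟩ := L.fiberMap_of_eq_one p₁ _ hfrac h₁
  refine ⟨lineOpen L.mat.det, L.domain _, L.family _, p₀, p₁, h₀.trans linePoint_zero,
    h₁.trans linePoint_one, L.family_over _, fun a ↦ ⟨L.fiberDomain_nonempty a,
    L.isOpenImmersion_fiberMap _ hfrac a⟩, L.fiberMap_of_eq_zero p₀ hJ h₀,
    l ≫ Scheme.homOfLE _ hqN, ?_, ?_⟩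
  · rw [Category.assoc, Scheme.homOfLE_ι, hl]
  · rw [Category.assoc, hlf]

end

/-! ### Transition maps in a chart, restriction of families, and the path between two birational
maps -/

section

variable {k : Type u} [Field k] {ι : Type u}

section Chart

variable {E X : Scheme.{u}} (j : E ⟶ X) (e : X.PartialIso X)

/-- A partial isomorphism of `X`, restricted to an open subscheme `E`. -/
def chartMap : (j ⁻¹ᵁ e.source).toScheme ⟶ X := j ∣_ e.source ≫ e.iso.hom ≫ e.target.ι

instance [IsOpenImmersion j] : IsOpenImmersion (chartMap j e) := by
  unfold chartMap
  infer_instance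

lemma chartMap_over {S : Scheme.{u}} {sX : X ⟶ S} (he : e.IsOver sX sX) :
    chartMap j e ≫ sX = (j ⁻¹ᵁ e.source).ι ≫ j ≫ sX := by
  rw [chartMap, Category.assoc, Category.assoc, he, morphismRestrict_ι_assoc]

lemma nonempty_preimage_source [IsOpenImmersion j] [Nonempty E] : Nonempty (j ⁻¹ᵁ e.source) := by
  obtain ⟨_, ⟨x, rfl⟩, hx⟩ := e.dense_source.inter_open_nonempty _ j.opensRange.2
    ⟨j (Classical.arbitrary E), Classical.arbitrary E, rfl⟩
  exact ⟨⟨x, hx⟩⟩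

/-- Two partial isomorphisms of an irreducible scheme differ, locally on a chart, by an open
immersion between open subschemes of the chart. -/
lemma exists_transition [IrreducibleSpace X] [IsOpenImmersion j] [Nonempty E]
    (e₀ e₁ : X.PartialIso X) :
    ∃ (N : E.Opens) (c : N.toScheme ⟶ j ⁻¹ᵁ e₁.source) (h : N.toScheme ⟶ j ⁻¹ᵁ e₀.source),
      Nonempty N ∧ IsOpenImmersion h ∧ c ≫ Scheme.Opens.ι _ = N.ι ∧
        h ≫ chartMap j e₀ = c ≫ chartMap j e₁ := by
  have := nonempty_preimage_source j e₀
  have := nonempty_preimage_source j e₁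
  -- The locus where `e₁` takes values in the image of the chart under `e₀`. It is nonempty because
  -- the two images are nonempty opens of an irreducible space.
  let N₀ := chartMap j e₁ ⁻¹ᵁ (chartMap j e₀).opensRange
  have hN₀ : Nonempty N₀ := by
    obtain ⟨_, ⟨x, rfl⟩, hx⟩ := (dense_opensRange (chartMap j e₀)).inter_open_nonempty _
      (chartMap j e₁).opensRange.2 ⟨_, Classical.arbitrary _, rfl⟩
    exact ⟨⟨x, hx⟩⟩
  let N := (j ⁻¹ᵁ e₁.source).ι ''ᵁ N₀
  let i := (j ⁻¹ᵁ e₁.source).ι.isoImage N₀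
  have hr : Set.range (i.inv ≫ N₀.ι ≫ chartMap j e₁) ⊆ Set.range (chartMap j e₀) := by
    rintro _ ⟨x, rfl⟩
    rw [Scheme.Hom.comp_apply, Scheme.Hom.comp_apply]
    exact (i.inv x).2
  have hl := IsOpenImmersion.lift_fac (chartMap j e₀) (i.inv ≫ N₀.ι ≫ chartMap j e₁) hr
  -- The lift through `chartMap j e₀` is `e₀⁻¹ e₁` in the chart.
  refine ⟨N, i.inv ≫ N₀.ι, IsOpenImmersion.lift _ _ hr, ⟨i.hom hN₀.some⟩, ?_, ?_, ?_⟩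
  · have : IsOpenImmersion (IsOpenImmersion.lift _ _ hr ≫ chartMap j e₀) := by
      rw [hl]
      infer_instance
    exact IsOpenImmersion.of_comp _ (chartMap j e₀)
  · rw [Category.assoc, Scheme.Hom.isoImage_inv_ι]
  · rw [hl, Category.assoc]

end Chart

section Restrict

variable {A E : Scheme.{u}} {sA : A ⟶ Spec (.of k)} {sE : E ⟶ Spec (.of k)}
  {V : (pullback sA sE).Opens} (h : V.toScheme ⟶ E) (W : E.Opens)

/-- The open locus of a family which is mapped to `W`. -/
abbrev restrictOpen : (pullback sA sE).Opens := V.ι ''ᵁ h ⁻¹ᵁ W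

/-- The restriction of a family to the locus which is mapped to `W`. -/
def restrictMap : (restrictOpen h W).toScheme ⟶ W := (V.ι.isoImage _).inv ≫ h ∣_ W

lemma restrictOpen_le : restrictOpen h W ≤ V := by
  rintro _ ⟨x, -, rfl⟩
  exact x.2

lemma restrictMap_ι : restrictMap h W ≫ W.ι = Scheme.homOfLE _ (restrictOpen_le h W) ≫ h := by
  have : (V.ι.isoImage (h ⁻¹ᵁ W)).inv ≫ (h ⁻¹ᵁ W).ι = Scheme.homOfLE _ (restrictOpen_le h W) := by
    rw [← cancel_mono V.ι, Category.assoc, Scheme.Hom.isoImage_inv_ι, Scheme.homOfLE_ι]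
  rw [restrictMap, Category.assoc, morphismRestrict_ι, reassoc_of% this]

variable (a : Points sA)

lemma fiberInclusion_restrictOpen_le :
    fiberInclusion sE a ⁻¹ᵁ restrictOpen h W ≤ fiberInclusion sE a ⁻¹ᵁ V :=
  fun _ hx ↦ restrictOpen_le h W hx

lemma fiber_restrictMap_ι : (fiberInclusion sE a ∣_ restrictOpen h W ≫ restrictMap h W) ≫ W.ι =
    Scheme.homOfLE _ (fiberInclusion_restrictOpen_le h W a) ≫ fiberInclusion sE a ∣_ V ≫ h := by
  have : fiberInclusion sE a ∣_ restrictOpen h W ≫ Scheme.homOfLE _ (restrictOpen_le h W) =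
      Scheme.homOfLE _ (fiberInclusion_restrictOpen_le h W a) ≫ fiberInclusion sE a ∣_ V := by
    rw [← cancel_mono V.ι, Category.assoc, Scheme.homOfLE_ι, Category.assoc, morphismRestrict_ι,
      morphismRestrict_ι, Scheme.homOfLE_ι_assoc]
  rw [Category.assoc, restrictMap_ι, reassoc_of% this]

lemma isOpenImmersion_fiber_restrictMap [IsOpenImmersion (fiberInclusion sE a ∣_ V ≫ h)] :
    IsOpenImmersion (fiberInclusion sE a ∣_ restrictOpen h W ≫ restrictMap h W) := by
  have : IsOpenImmersion
      ((fiberInclusion sE a ∣_ restrictOpen h W ≫ restrictMap h W) ≫ W.ι) := by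
    rw [fiber_restrictMap_ι]
    infer_instance
  exact IsOpenImmersion.of_comp _ W.ι

/-- The image of the fibre is a nonempty open of the irreducible scheme `E`, so it meets `W`. -/
lemma nonempty_fiber_restrictOpen [IrreducibleSpace E] [Nonempty W]
    [Nonempty (fiberInclusion sE a ⁻¹ᵁ V)] [IsOpenImmersion (fiberInclusion sE a ∣_ V ≫ h)] :
    Nonempty (fiberInclusion sE a ⁻¹ᵁ restrictOpen h W) := by
  obtain ⟨_, hy, x, rfl⟩ := (dense_opensRange (fiberInclusion sE a ∣_ V ≫ h)).inter_open_nonempty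
    W W.2 ⟨_, (Classical.arbitrary W).2⟩
  refine ⟨⟨x.1, (fiberInclusion sE a ∣_ V) x, ?_, ?_⟩⟩
  · exact hy
  · have := congrArg (fun g ↦ g x) (morphismRestrict_ι (fiberInclusion sE a) V)
    exact this

end Restrict

variable [Fintype ι]

instance (U : (AffineLine k).Opens) [Nonempty U] : Surjective (U.ι ≫ AffineLine.hom k) :=
  ⟨fun _ ↦ ⟨Classical.arbitrary _, Subsingleton.elim _ _⟩⟩

/-- An irreducible scheme which contains an affine space as an open subscheme has a linearly
connected group of birational maps. -/
theorem isLinearlyConnected_of_chart [Infinite k] {X : Scheme.{u}} (sX : X ⟶ Spec (.of k))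
    [IrreducibleSpace X] (j : AffSp k ι ⟶ X) [IsOpenImmersion j] (hj : j ≫ sX = AffSp.hom k ι) :
    IsLinearlyConnected sX := by
  rintro f₀ f₁
  obtain ⟨e₀, he₀, hf₀⟩ := f₀.2
  obtain ⟨e₁, he₁, hf₁⟩ := f₁.2
  obtain ⟨N, c, t, hN, ht, hc, htc⟩ := exists_transition j e₀ e₁
  have hover : (t ≫ Scheme.Opens.ι _) ≫ AffSp.hom k ι = N.ι ≫ AffSp.hom k ι := by
    have h₀ := chartMap_over j e₀ he₀
    have h₁ := chartMap_over j e₁ he₁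
    rw [hj] at h₀ h₁
    rw [Category.assoc, ← h₀, reassoc_of% htc, h₁, reassoc_of% hc]
  -- Here `t` plays the role of `f₀⁻¹ f₁`. The path is `f₀ ∘ h_s`, where `h_s` runs from the
  -- identity to `t`.
  obtain ⟨U, V, h, p₀, p₁, hp₀, hp₁, hh, hV, hV₀, l, hl, hl₁⟩ :=
    exists_family_through N (t ≫ Scheme.Opens.ι _) hover
  have := nonempty_preimage_source j e₀
  have hne (a : Points (U.ι ≫ AffineLine.hom k)) :
      Nonempty (fiberInclusion (AffSp.hom k ι) a ⁻¹ᵁ restrictOpen h (j ⁻¹ᵁ e₀.source)) :=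
    have := (hV a).1
    have := (hV a).2
    nonempty_fiber_restrictOpen h _ a
  have himm (a : Points (U.ι ≫ AffineLine.hom k)) :
      IsOpenImmersion (fiberInclusion (AffSp.hom k ι) a ∣_ restrictOpen h (j ⁻¹ᵁ e₀.source) ≫
        restrictMap h (j ⁻¹ᵁ e₀.source) ≫ chartMap j e₀) := by
    have := (hV a).2
    have := isOpenImmersion_fiber_restrictMap h (j ⁻¹ᵁ e₀.source) a
    rw [← Category.assoc]
    infer_instance
  have : Nonempty U := ⟨p₀.1 (IsLocalRing.closedPoint k)⟩
  have : Nonempty (restrictOpen h (j ⁻¹ᵁ e₀.source)) :=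
    ⟨(fiberInclusion (AffSp.hom k ι) p₀ ∣_ _) (hne p₀).some⟩
  have hover' : (restrictMap h (j ⁻¹ᵁ e₀.source) ≫ chartMap j e₀) ≫ sX =
      (restrictOpen h (j ⁻¹ᵁ e₀.source)).ι ≫ pullback.snd _ _ ≫ AffSp.hom k ι := by
    rw [Category.assoc, chartMap_over j e₀ he₀, hj, reassoc_of% restrictMap_ι h, hh,
      Scheme.homOfLE_ι_assoc]
  refine ⟨U, _, p₀, p₁, ⟨AlgebraicFamily.extend j hj (restrictOpen h (j ⁻¹ᵁ e₀.source))
    (restrictMap h (j ⁻¹ᵁ e₀.source) ≫ chartMap j e₀) hover' hne himm, rfl⟩, hp₀, hp₁, ?_, ?_⟩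
  · have key := fiber_restrictMap_ι h (j ⁻¹ᵁ e₀.source) p₀
    rw [hV₀, Scheme.homOfLE_ι] at key
    refine AlgebraicFamily.extend_eval_eq j hj _ _ hover' hne himm p₀ f₀ e₀ hf₀
      ((fiberInclusion (AffSp.hom k ι) p₀ ∣_ _ ≫ restrictMap h _) ≫ j ∣_ e₀.source) ?_ ?_
    · rw [Category.assoc, morphismRestrict_ι, ← Category.assoc, key]
    · simp only [Category.assoc, chartMap]
  · have key := fiber_restrictMap_ι h (j ⁻¹ᵁ e₀.source) p₁
    -- Cancelling the inclusion of the domain of `e₀` shows that the fibre at `p₁` is a restriction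
    -- of `t`; `htc` then turns `f₀ ∘ t` into `f₁`.
    rw [← hl₁, ← Category.assoc, ← Category.assoc, cancel_mono] at key
    refine AlgebraicFamily.extend_eval_eq j hj _ _ hover' hne himm p₁ f₁ e₁ hf₁
      (Scheme.homOfLE _ (fiberInclusion_restrictOpen_le h _ p₁) ≫ l ≫ c ≫ j ∣_ e₁.source) ?_ ?_
    · rw [Category.assoc, Category.assoc, Category.assoc, morphismRestrict_ι, reassoc_of% hc,
        reassoc_of% hl, Scheme.homOfLE_ι_assoc]
    · rw [← Category.assoc (fiberInclusion _ _ ∣_ _), key]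
      simp only [Category.assoc]
      rw [htc]
      simp only [chartMap]

end

/-! ### Projective space: irreducibility and the standard chart -/

section

variable (k : Type u) [Field k] (n : ℕ)

attribute [local instance] MvPolynomial.gradedAlgebra

/-- The zero ideal is a generic point: it lies in every nonempty basic open. It is a point of `Proj`
because `X 0` is a nonzero element of the irrelevant ideal. -/
instance : IrreducibleSpace (ProjectiveSpace k n) := by
  let η : ProjectiveSpace k n :=
    { asHomogeneousIdeal := ⊥
      isPrime := by
        rw [HomogeneousIdeal.toIdeal_bot]
        exact Ideal.isPrime_bot
      not_irrelevant_le := by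
        intro h
        have h1 := h (HomogeneousIdeal.mem_irrelevant_of_mem _ one_pos
          ((MvPolynomial.mem_homogeneousSubmodule _ _).2 (MvPolynomial.isHomogeneous_X k 0)))
        have h2 : (MvPolynomial.X 0 : MvPolynomial (Fin (n + 1)) k) = 0 := h1
        exact MvPolynomial.X_ne_zero _ h2 }
  have hη : closure {η} = Set.univ := by
    rw [← dense_iff_closure_eq]
    refine (Proj.isBasis_basicOpen
      (MvPolynomial.homogeneousSubmodule (Fin (n + 1)) k)).dense_iff.2 ?_
    rintro _ ⟨_, ⟨f, rfl⟩, rfl⟩ ⟨x, hx⟩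
    refine ⟨η, ?_, rfl⟩
    intro h
    have h2 : f = 0 := h
    subst h2
    simp at hx
  have h := (isIrreducible_singleton (x := η)).closure
  rw [hη] at h
  exact (irreducibleSpace_def _).2 h

variable {k n}

lemma eval₂Hom_mul_of_isHomogeneous {σ B : Type*} [CommRing B] {κ : k →+* B} {y : σ → B} {t : B}
    {d : ℕ} {r : MvPolynomial σ k} (hr : r.IsHomogeneous d) :
    MvPolynomial.eval₂Hom κ (fun i ↦ t * y i) r = t ^ d * MvPolynomial.eval₂Hom κ y r := by
  simp only [MvPolynomial.coe_eval₂Hom, MvPolynomial.eval₂_eq, Finset.mul_sum]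
  refine Finset.sum_congr rfl fun m hm ↦ ?_
  rw [hr.degree_eq_sum_deg_support hm, ← Finset.prod_pow_eq_pow_sum]
  simp only [mul_pow, Finset.prod_mul_distrib]
  ring

variable (k n)

/-- The ring of functions on the standard affine chart of projective space. -/
abbrev ChartRing : Type u :=
  HomogeneousLocalization.Away (MvPolynomial.homogeneousSubmodule (Fin (n + 1)) k)
    (MvPolynomial.X 0)

lemma X_mem (i : Fin (n + 1)) :
    (MvPolynomial.X i : MvPolynomial (Fin (n + 1)) k) ∈
      MvPolynomial.homogeneousSubmodule (Fin (n + 1)) k 1 :=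
  (MvPolynomial.mem_homogeneousSubmodule _ _).2 (MvPolynomial.isHomogeneous_X k i)

/-- The constants in the ring of functions on the standard affine chart. -/
def chartScalars : k →+* ChartRing k n :=
  (HomogeneousLocalization.fromZeroRingHom _ _).comp (algebraMap k _)

/-- The affine coordinates `x i / x 0`. -/
def chartCoord (i : Fin (n + 1)) : ChartRing k n :=
  HomogeneousLocalization.Away.mk _ (X_mem k n 0) 1 (MvPolynomial.X i) (X_mem k n i)

/-- The identification of polynomials in `n` variables with functions on the standard chart. -/
def chartHom : MvPolynomial (ULift.{u} (Fin n)) k →+* ChartRing k n :=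
  MvPolynomial.eval₂Hom (chartScalars k n) fun i ↦ chartCoord k n i.down.succ

/-- The dehomogenisation of a polynomial. -/
def dehomogenize : MvPolynomial (Fin (n + 1)) k →ₐ[k] MvPolynomial (ULift.{u} (Fin n)) k :=
  MvPolynomial.aeval (Fin.cons 1 fun i ↦ .X ⟨i⟩)

lemma chartCoord_zero : chartCoord k n 0 = 1 := by
  apply HomogeneousLocalization.val_injective
  rw [chartCoord, HomogeneousLocalization.Away.val_mk, HomogeneousLocalization.val_one,
    ← Localization.mk_one, Localization.mk_eq_mk_iff, Localization.r_iff_exists]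
  exact ⟨1, by simp⟩

lemma chartHom_dehomogenize (r : MvPolynomial (Fin (n + 1)) k) :
    chartHom k n (dehomogenize k n r) =
      MvPolynomial.eval₂Hom (chartScalars k n) (chartCoord k n) r := by
  suffices h : (chartHom k n).comp (dehomogenize k n : _ →+* _) =
      MvPolynomial.eval₂Hom (chartScalars k n) (chartCoord k n) from
    congrArg (fun g : _ →+* _ ↦ g r) h
  refine MvPolynomial.ringHom_ext (fun c ↦ ?_) fun i ↦ ?_
  · simp [chartHom, dehomogenize, MvPolynomial.algebraMap_eq]
  · refine Fin.cases ?_ (fun i ↦ ?_) i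
    · simp [dehomogenize, chartCoord_zero]
    · simp [dehomogenize, chartHom]

/-- Substitute `X i = X 0 · (X i / X 0)`. For homogeneous `r` of degree `d`, the power `X 0 ^ d`
then factors out, which gives `mk_eq_eval₂Hom`. -/
lemma algebraMap_eq_eval₂Hom (r : MvPolynomial (Fin (n + 1)) k) :
    algebraMap _ (Localization (Submonoid.powers
      (MvPolynomial.X 0 : MvPolynomial (Fin (n + 1)) k))) r =
    MvPolynomial.eval₂Hom ((algebraMap (ChartRing k n) _).comp (chartScalars k n))
      (fun i ↦ algebraMap _ _ (MvPolynomial.X 0 : MvPolynomial (Fin (n + 1)) k) *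
        (chartCoord k n i).val) r := by
  suffices h : algebraMap _ (Localization (Submonoid.powers
      (MvPolynomial.X 0 : MvPolynomial (Fin (n + 1)) k))) =
      MvPolynomial.eval₂Hom ((algebraMap (ChartRing k n) _).comp (chartScalars k n))
      (fun i ↦ algebraMap _ _ (MvPolynomial.X 0 : MvPolynomial (Fin (n + 1)) k) *
        (chartCoord k n i).val) from
    congrArg (fun g : _ →+* _ ↦ g r) h
  refine MvPolynomial.ringHom_ext (fun c ↦ ?_) fun i ↦ ?_
  · rw [MvPolynomial.eval₂Hom_C]
    exact (Localization.mk_one_eq_algebraMap _).symm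
  · rw [MvPolynomial.eval₂Hom_X', chartCoord, HomogeneousLocalization.Away.val_mk,
      ← Localization.mk_one_eq_algebraMap, ← Localization.mk_one_eq_algebraMap, Localization.mk_mul,
      Localization.mk_eq_mk_iff, Localization.r_iff_exists]
    exact ⟨1, by simp⟩

lemma mk_eq_eval₂Hom (d : ℕ) (r : MvPolynomial (Fin (n + 1)) k)
    (hr : r ∈ MvPolynomial.homogeneousSubmodule (Fin (n + 1)) k (d • 1)) :
    HomogeneousLocalization.Away.mk _ (X_mem k n 0) d r hr =
      MvPolynomial.eval₂Hom (chartScalars k n) (chartCoord k n) r := by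
  apply HomogeneousLocalization.val_injective
  have h1 := algebraMap_eq_eval₂Hom k n r
  rw [eval₂Hom_mul_of_isHomogeneous ((MvPolynomial.mem_homogeneousSubmodule _ _).1 hr)] at h1
  have h2 : (MvPolynomial.eval₂Hom (chartScalars k n) (chartCoord k n) r).val =
      MvPolynomial.eval₂Hom ((algebraMap (ChartRing k n) (Localization (Submonoid.powers
      (MvPolynomial.X 0 : MvPolynomial (Fin (n + 1)) k)))).comp (chartScalars k n))
        (fun i ↦ (chartCoord k n i).val) r :=
    map_eval₂Hom (algebraMap (ChartRing k n) (Localization (Submonoid.powers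
      (MvPolynomial.X 0 : MvPolynomial (Fin (n + 1)) k)))) _ _ _
  rw [← h2] at h1
  rw [HomogeneousLocalization.Away.val_mk, Localization.mk_eq_mk', IsLocalization.mk'_eq_iff_eq_mul,
    h1, mul_comm, map_pow, smul_eq_mul, mul_one]

/-- Dehomogenisation sends `X 0` to `1`, so it extends to the localisation and gives a left inverse.
Conversely `r / X 0 ^ d` is the image of the dehomogenisation of `r`. -/
lemma chartHom_bijective : Function.Bijective (chartHom k n) := by
  constructor
  · let ψ₀ : Localization (Submonoid.powers (MvPolynomial.X 0 : MvPolynomial (Fin (n + 1)) k)) →+*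
        MvPolynomial (ULift.{u} (Fin n)) k :=
      IsLocalization.Away.lift (MvPolynomial.X 0 : MvPolynomial (Fin (n + 1)) k)
        (g := (dehomogenize k n).toRingHom)
        (by simp [dehomogenize])
    let ψ : ChartRing k n →+* MvPolynomial (ULift.{u} (Fin n)) k :=
      ψ₀.comp (algebraMap (ChartRing k n) _)
    have hψ₀ (r) : ψ₀ (algebraMap _ _ r) = dehomogenize k n r := IsLocalization.Away.lift_eq _ _ _
    have h : ψ.comp (chartHom k n) = RingHom.id _ := by
      refine MvPolynomial.ringHom_ext (fun c ↦ ?_) fun i ↦ ?_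
      · have h1 : ψ (chartScalars k n c) = ψ₀ (algebraMap _ _ (MvPolynomial.C c)) :=
          congrArg ψ₀ (Localization.mk_one_eq_algebraMap _)
        rw [RingHom.comp_apply, chartHom, MvPolynomial.eval₂Hom_C, h1, hψ₀]
        simp [dehomogenize, MvPolynomial.algebraMap_eq]
      · have h1 := congrArg ψ₀ (algebraMap_eq_eval₂Hom k n (MvPolynomial.X i.down.succ))
        rw [MvPolynomial.eval₂Hom_X', map_mul, hψ₀, hψ₀] at h1
        simp only [dehomogenize, MvPolynomial.aeval_X, Fin.cons_zero, Fin.cons_succ,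
          one_mul] at h1
        rw [RingHom.comp_apply, chartHom, MvPolynomial.eval₂Hom_X']
        exact h1.symm
    exact Function.LeftInverse.injective (g := ψ) fun r ↦ congrArg (fun g : _ →+* _ ↦ g r) h
  · intro x
    obtain ⟨d, r, hr, rfl⟩ := HomogeneousLocalization.Away.mk_surjective _ (X_mem k n 0) x
    exact ⟨dehomogenize k n r, by rw [chartHom_dehomogenize, mk_eq_eval₂Hom]⟩

/-- The standard affine chart of projective space. -/
def chart : AffSp k (ULift.{u} (Fin n)) ⟶ ProjectiveSpace k n :=
  have : IsIso (CommRingCat.ofHom (chartHom k n)) :=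
    (ConcreteCategory.isIso_iff_bijective (CommRingCat.ofHom (chartHom k n))).2
      (chartHom_bijective k n)
  (AffineSpace.SpecIso _ (.of k)).hom ≫ inv (Spec.map (CommRingCat.ofHom (chartHom k n))) ≫
    Proj.awayι _ (MvPolynomial.X 0) (X_mem k n 0) one_pos

instance : IsOpenImmersion (chart k n) := by
  have : IsIso (CommRingCat.ofHom (chartHom k n)) :=
    (ConcreteCategory.isIso_iff_bijective (CommRingCat.ofHom (chartHom k n))).2
      (chartHom_bijective k n)
  unfold chart
  infer_instance

lemma chart_over : chart k n ≫ ProjectiveSpace.hom k n = AffSp.hom k _ := by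
  have : IsIso (CommRingCat.ofHom (chartHom k n)) :=
    (ConcreteCategory.isIso_iff_bijective (CommRingCat.ofHom (chartHom k n))).2
      (chartHom_bijective k n)
  have h1 : Proj.awayι _ (MvPolynomial.X 0) (X_mem k n 0) one_pos ≫ ProjectiveSpace.hom k n =
      Spec.map (CommRingCat.ofHom (chartScalars k n)) := by
    rw [ProjectiveSpace.hom, Proj.awayι_toSpecZero_assoc, ← Spec.map_comp]
    rfl
  have h2 : Spec.map (CommRingCat.ofHom (chartScalars k n)) =
      Spec.map (CommRingCat.ofHom (chartHom k n)) ≫ Spec.map (CommRingCat.ofHom MvPolynomial.C) := by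
    rw [← Spec.map_comp, ← CommRingCat.ofHom_comp, chartHom, MvPolynomial.eval₂Hom_comp_C]
  rw [chart, Category.assoc, Category.assoc, h1, h2, IsIso.inv_hom_id_assoc]
  exact ((Iso.inv_comp_eq _).1 (AffineSpace.SpecIso_inv_over (.of k))).symm

end

/-! ### From linear connectedness to connectedness -/

section

variable {k : Type u} [Field k]

lemma exists_linePoint_mem [Infinite k] (N : (AffineLine k).Opens) [Nonempty N] :
    ∃ c : k, linePoint c (IsLocalRing.closedPoint k) ∈ N := by
  obtain ⟨q, p, hpq, hq⟩ := exists_basicOpen_polyFun_le N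
  refine ⟨p PUnit.unit, hq ?_⟩
  have h : IsUnit ((linePoint (p PUnit.unit)).appTop.hom (polyFun q)) := by
    rw [linePoint, homOfVector_appTop_polyFun,
      show (fun _ ↦ scalars (𝟙 _) (p PUnit.unit)) = fun i ↦ scalars (𝟙 (Spec (.of k))) (p i) from
        rfl, eval₂Hom_comp, hpq, map_one]
    exact isUnit_one
  have := range_subset_range_basicOpen_ι _ _ h
  rw [Scheme.Opens.range_ι] at this
  exact this ⟨_, rfl⟩

lemma exists_point_comp_eq {A : Scheme.{u}} {sA : A ⟶ Spec (.of k)} {U : A.Opens}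
    (p : Spec (.of k) ⟶ A) (hp : p ≫ sA = 𝟙 _) (hU : p (IsLocalRing.closedPoint k) ∈ U) :
    ∃ a : Points (U.ι ≫ sA), a.1 ≫ U.ι = p := by
  have hr : Set.range p ⊆ Set.range U.ι := by
    rintro _ ⟨x, rfl⟩
    rw [Scheme.Opens.range_ι, Subsingleton.elim x (IsLocalRing.closedPoint k)]
    exact hU
  have h := IsOpenImmersion.lift_fac U.ι p hr
  exact ⟨⟨_, (Category.assoc _ _ _).symm.trans ((congrArg (· ≫ sA) h).trans hp)⟩, h⟩

/-- Two nonempty opens of the space of rational points come from opens of the irreducible line.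
These meet in a nonempty open, which contains a rational point since `k` is infinite. -/
lemma preconnectedSpace_points [Infinite k] (U : (AffineLine k).Opens) :
    PreconnectedSpace (Points (U.ι ≫ AffineLine.hom k)) := by
  have : PreirreducibleSpace (Points (U.ι ≫ AffineLine.hom k)) := by
    refine ⟨?_⟩
    rintro _ _ ⟨S, hS, rfl⟩ ⟨S', hS', rfl⟩ ⟨x, -, hx⟩ ⟨y, -, hy⟩
    let N : (AffineLine k).Opens := U.ι ''ᵁ ⟨S, hS⟩
    let N' : (AffineLine k).Opens := U.ι ''ᵁ ⟨S', hS'⟩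
    let M : (AffineLine k).Opens := N ⊓ N'
    obtain ⟨z, hz⟩ := nonempty_preirreducible_inter N.2 N'.2 ⟨_, _, hx, rfl⟩ ⟨_, _, hy, rfl⟩
    have : Nonempty M := ⟨⟨z, hz⟩⟩
    obtain ⟨c, ⟨z₁, hz₁, h₁⟩, ⟨z₂, hz₂, h₂⟩⟩ := exists_linePoint_mem M
    obtain ⟨a, ha⟩ := exists_point_comp_eq (U := U) (linePoint c) (linePoint_over c)
      (h₁ ▸ z₁.2)
    have ha' : U.ι (a.1 (IsLocalRing.closedPoint k)) = linePoint c (IsLocalRing.closedPoint k) :=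
      congrArg (fun g ↦ g (IsLocalRing.closedPoint k)) ha
    have e₁ : a.1 (IsLocalRing.closedPoint k) = z₁ :=
      U.ι.isOpenEmbedding.injective (ha'.trans h₁.symm)
    have e₂ : a.1 (IsLocalRing.closedPoint k) = z₂ :=
      U.ι.isOpenEmbedding.injective (ha'.trans h₂.symm)
    refine ⟨a, trivial, ?_, ?_⟩
    · change a.1 (IsLocalRing.closedPoint k) ∈ S
      rw [e₁]
      exact hz₁
    · change a.1 (IsLocalRing.closedPoint k) ∈ S'
      rw [e₂]
      exact hz₂
  infer_instance

instance isVariety_line (U : (AffineLine k).Opens) : IsVariety (U.ι ≫ AffineLine.hom k) where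
  isReduced := inferInstance
  isSeparated := inferInstance
  locallyOfFiniteType := inferInstance
  quasiCompact := by
    -- Open immersions into a locally Noetherian scheme are quasi-compact.
    have : IsLocallyNoetherian (AffineLine k) :=
      LocallyOfFiniteType.isLocallyNoetherian (AffineLine.hom k)
    infer_instance

lemma IsMorphism.continuous {A X : Scheme.{u}} {sA : A ⟶ Spec (.of k)} {sX : X ⟶ Spec (.of k)}
    [hA : IsVariety sA] {θ : Points sA → Bir sX} (hθ : IsMorphism θ) : Continuous θ := by
  refine continuous_iff_isClosed.2 fun R hR ↦ ?_
  -- `TopologicalSpace.ofClosed` declares a set open when its complement is in the given family, so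
  -- this exposes the defining condition, for the double complement of `R`.
  rw [← isOpen_compl_iff] at hR
  have := hR A sA hA θ hθ
  simpa using this

theorem connectedSpace_of_isLinearlyConnected [Infinite k] {X : Scheme.{u}}
    (sX : X ⟶ Spec (.of k)) (h : IsLinearlyConnected sX) : ConnectedSpace (Bir sX) where
  isPreconnected_univ := by
    refine isPreconnected_of_forall_pair fun f _ g _ ↦ ?_
    obtain ⟨U, θ, p₀, p₁, hθ, -, -, rfl, rfl⟩ := h f g
    have := preconnectedSpace_points U
    exact ⟨Set.range θ, Set.subset_univ _, ⟨p₀, rfl⟩, ⟨p₁, rfl⟩,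
      isPreconnected_range hθ.continuous⟩
  toNonempty := ⟨⟨_, Scheme.PartialIso.refl X, Category.id_comp _, rfl⟩⟩

end

end Cremona

end

theorem mainTheorem2 (k : Type u) [Field k] [IsAlgClosed k] (n : ℕ) (hn : 1 ≤ n) :
    Cremona.IsLinearlyConnected (Cremona.ProjectiveSpace.hom k n) ∧
      ConnectedSpace (Cremona.Cr k n) := by
  have : Infinite k := IsAlgClosed.instInfinite
  have h := Cremona.isLinearlyConnected_of_chart (Cremona.ProjectiveSpace.hom k n)
    (Cremona.chart k n) (Cremona.chart_over k n)
  exact ⟨h, Cremona.connectedSpace_of_isLinearlyConnected _ h⟩
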